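/- Let $p>1$ and $0<u<p$ be real numbers and let $d$ be a non-negative integer or $d=\infty$. Write $(x)_k=\prod_{i=0}^{k-1}(1-x/p^i)$ for $k$ a non-negative integer or $\infty$. For a partition $\lambda$ let $|\lambda|$ be its size, $r(\lambda)$ its number of parts, $m_i(\lambda)$ the number of its parts equal to $i$, and $\lambda_i'$ the number of its parts that are at least $i$; put $$|\mathrm{Aut}(\lambda)|=p^{\sum_i(\lambda_i')^2}\prod_{i\ge1}(1/p)_{m_i(\lambda)} .$$ For partitions $\lambda,\mu$ let $n_\lambda(\mu)$ be the value at $p$ of the polynomial whose value at every prime $q$ is the number of subgroups of type $\mu$ of a finite abelian $q$-group of type $\lambda$ (the group $\prod_i\mathbb Z/q^{\lambda_i}\mathbb Z$), and put $|\mathrm{Sur}(\lambda,\mu)|=n_\lambda(\mu)\,|\mathrm{Aut}(\mu)|$; when $p$ is prime this is the number of surjective homomorphisms from a finite abelian $p$-group of type $\lambda$ onto one of type $\mu$. Let $$P_{d,u}(\lambda)=\frac{u^{|\lambda|}}{|\mathrm{Aut}(\lambda)|}\,(u/p)_d\,\frac{(1/p)_d}{(1/p)_{d-r(\lambda)}}\quad\text{if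 } r(\lambda)\le d,\qquad P_{d,u}(\lambda)=0\quad\text{otherwise},$$ where $\infty-r=\infty$. Theorem. Suppose that $$\frac1{(u/p)_d}=\prod_{i=1}^{d}(1-u/p^i)^{-1}<2 .$$ If $\nu$ is a probability measure on the set of all partitions such that for every partition $\mu$ $$\sum_\lambda \nu(\lambda)\,|\mathrm{Sur}(\lambda,\mu)|=\begin{cases}\dfrac{u^{|\mu|}(1/p)_d}{(1/p)_{d-r(\mu)}} & \text{if } r(\mu)\le d,\\[2mm] 0&\text{otherwise,}\end{cases}$$ then $\nu=P_{d,u}$, that is, $\nu(\lambda)=P_{d,u}(\lambda)$ for every partition $\lambda$. -/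

import Mathlib

open Polynomial

noncomputable section

namespace CohenLenstra

/-! Partitions are Young diagrams: with zero-based indices, the parts of `lam` are
`lam.rowLen 0 ≥ lam.rowLen 1 ≥ ⋯`, the columns (parts of the conjugate partition) are
`lam.colLen 0 ≥ lam.colLen 1 ≥ ⋯`, and the size is `lam.card`. -/

/-- The number of (nonzero) parts `r(lam)`. -/
abbrev numParts (lam : YoungDiagram) : ℕ := lam.colLen 0

/-- The multiplicity `m_i(lam)`: the number of parts of size `i`. -/
def multiplicity (lam : YoungDiagram) (i : ℕ) : ℕ := lam.rowLens.count i

/-- `(x)_d = (1 - x) (1 - x/p) ⋯ (1 - x/p^(d-1))`, for `d` a natural number or `∞`. -/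
def poch (p x : ℝ) (d : ℕ∞) : ℝ :=
  if d = ⊤ then ∏' i : ℕ, (1 - x / p ^ i) else ∏ i ∈ Finset.range d.toNat, (1 - x / p ^ i)

/-- `|Aut(lam)| = p^(∑ (lam'_i)^2) ∏_i (1/p)_{m_i(lam)}`, for real `p`. -/
def autCard (p : ℝ) (lam : YoungDiagram) : ℝ :=
  p ^ (∑ j ∈ Finset.range (lam.rowLen 0), lam.colLen j ^ 2) *
    ∏ i ∈ Finset.Icc 1 (lam.rowLen 0), poch p (1 / p) (multiplicity lam i)

/-- The mass `P_{d,u}(lam)`, for real `p` and for `d` a natural number or `∞`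
(for `d = ∞` the last quotient is `1`). -/
def cohenLenstraMass (p u : ℝ) (d : ℕ∞) (lam : YoungDiagram) : ℝ :=
  if (numParts lam : ℕ∞) ≤ d then
    u ^ lam.card / autCard p lam * poch p (u / p) d *
      (poch p (1 / p) d / poch p (1 / p) (d - numParts lam))
  else 0

/-- `ℤ/q^{lam_1} × ⋯ × ℤ/q^{lam_r}`: the finite abelian `q`-group of type `lam`, `q` prime. -/
abbrev GroupOfType (q : ℕ) (lam : YoungDiagram) : Type :=
  (i : Fin (numParts lam)) → ZMod (q ^ lam.rowLen i)

/-- The number of subgroups of type `mu` of a finite abelian `q`-group of type `lam`. -/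
def subgroupCount (q : ℕ) (lam mu : YoungDiagram) : ℕ :=
  Nat.card {H : AddSubgroup (GroupOfType q lam) // Nonempty (H ≃+ GroupOfType q mu)}

open Classical in
/-- `n_lam(mu)` as a polynomial: the polynomial whose value at every prime `q` is the number of
subgroups of type `mu` of a finite abelian `q`-group of type `lam`. -/
def subgroupPoly (lam mu : YoungDiagram) : ℝ[X] :=
  if h : ∃ f : ℝ[X], ∀ q : ℕ, q.Prime → f.eval (q : ℝ) = subgroupCount q lam mu
  then h.choose else 0

/-- At most one polynomial has the required values, so `subgroupPoly` involves no choice. -/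
theorem subgroupPoly_eq (lam mu : YoungDiagram) (f : ℝ[X])
    (hf : ∀ q : ℕ, q.Prime → f.eval (q : ℝ) = subgroupCount q lam mu) :
    subgroupPoly lam mu = f := by
  have h : ∃ f : ℝ[X], ∀ q : ℕ, q.Prime → f.eval (q : ℝ) = subgroupCount q lam mu := ⟨f, hf⟩
  rw [subgroupPoly, dif_pos h]
  refine Polynomial.eq_of_infinite_eval_eq _ _
    (((Nat.infinite_setOfPred_prime).image (f := fun n : ℕ => (n : ℝ))
      Nat.cast_injective.injOn).mono ?_)
  rintro _ ⟨q, hq, rfl⟩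
  exact (h.choose_spec q hq).trans (hf q hq).symm

/-- `|Sur(lam, mu)| = n_lam(mu) |Aut(mu)|`, for real `p`. -/
def surCard (p : ℝ) (lam mu : YoungDiagram) : ℝ :=
  (subgroupPoly lam mu).eval p * autCard p mu

/-- The value `u^|mu| (1/p)_d / (1/p)_{d - r(mu)}` if `r(mu) ≤ d`, and `0` otherwise. -/
def momentValue (p u : ℝ) (d : ℕ∞) (mu : YoungDiagram) : ℝ :=
  if (numParts mu : ℕ∞) ≤ d then
    u ^ mu.card * poch p (1 / p) d / poch p (1 / p) (d - numParts mu)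
  else 0

end CohenLenstra

end

noncomputable section

namespace CohenLenstra

open Filter Topology
open scoped ENNReal

/-! Write `M(μ)` for the prescribed moment, `w(λ) = M(λ)/|Aut(λ)|` and `R = (u/p)_d`, so that
`P_{d,u} = R w`. Uniqueness is a contraction argument. The term `λ = μ` of the moment condition
gives `ν ≤ w`, so the difference `e = ν - P_{d,u}` satisfies `|e| ≤ C w`. If `P_{d,u}` has the
moments `M`, then all moments of `e` vanish. Isolating the term `λ = μ`, whose coefficient is
`|Aut(μ)|`, and bounding the other terms by `C w` gives `|e(μ)| |Aut(μ)| ≤ C (∑ w(λ) |Sur(λ,μ)| -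
M(μ)) = C (1/R - 1) M(μ)`. Hence `C` may be replaced by `C (1/R - 1)`. The condition `1/R < 2` makes
this factor less than `1`, and iteration gives `e = 0` (`abs_le_of_hasSum_zero`,
`eq_zero_of_hasSum_zero`).

The main work is the moment formula `∑ w(λ) |Sur(λ,μ)| = M(μ)/R`. The product `n_λ(μ) |Aut(μ)|`
counts injections from type `μ` into type `λ`, and choosing images of generators one at a time gives
an explicit product (`surCard_eq_injCard`). This product, `|Aut|` and the size all factor when the
first column is removed. The sums over `λ` with first column of length `a` therefore satisfy a
recursion over the length `b ≤ a` of the second column, and a `q`-Vandermonde identity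
(`sum_cauchy`) solves it in closed form (`rankSum_eq`). Summing over `a` uses the same identity for
finite `d` and dominated convergence for `d = ∞` (`hasSum_rankFactor`). -/

/-! ### Finite products and the Cauchy identity. -/

/-- The finite product `(1 - v/p) (1 - v/p^2) ⋯ (1 - v/p^n)`. -/
def shiftedPoch (p v : ℝ) (n : ℕ) : ℝ := ∏ i ∈ Finset.range n, (1 - v / p ^ (i + 1))

theorem poch_div_natCast (p v : ℝ) (n : ℕ) : poch p (v / p) n = shiftedPoch p v n := by
  rw [poch, if_neg (ENat.natCast_ne_top n), shiftedPoch, ENat.toNat_natCast]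
  exact Finset.prod_congr rfl fun i _ => by rw [div_div, pow_succ']

@[simp] theorem shiftedPoch_zero (p v : ℝ) : shiftedPoch p v 0 = 1 := by simp [shiftedPoch]

theorem shiftedPoch_succ (p v : ℝ) (n : ℕ) :
    shiftedPoch p v (n + 1) = shiftedPoch p v n * (1 - v / p ^ (n + 1)) := by
  rw [shiftedPoch, Finset.prod_range_succ, ← shiftedPoch]

theorem shiftedPoch_add (p v : ℝ) (m n : ℕ) :
    shiftedPoch p v (m + n) = shiftedPoch p v m * shiftedPoch p (v / p ^ m) n := by
  rw [shiftedPoch, Finset.prod_range_add, ← shiftedPoch]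
  congr 1
  refine Finset.prod_congr rfl fun i _ => ?_
  rw [div_div, ← pow_add, add_assoc]

theorem one_sub_div_pow_pos {p v : ℝ} (hp : 1 < p) (hvp : v < p) (n : ℕ) :
    0 < 1 - v / p ^ (n + 1) := by
  have h : p ≤ p ^ (n + 1) := le_self_pow₀ hp.le (Nat.succ_ne_zero n)
  rw [sub_pos, div_lt_one (by linarith)]
  linarith

theorem shiftedPoch_pos {p v : ℝ} (hp : 1 < p) (hvp : v < p) (n : ℕ) :
    0 < shiftedPoch p v n :=
  Finset.prod_pos fun i _ => one_sub_div_pow_pos hp hvp i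

theorem shiftedPoch_antitone {p v : ℝ} (hp : 1 < p) (hv : 0 ≤ v) (hvp : v < p) :
    Antitone (shiftedPoch p v) := by
  refine antitone_nat_of_succ_le fun n => ?_
  rw [shiftedPoch_succ]
  refine mul_le_of_le_one_right (shiftedPoch_pos hp hvp n).le ?_
  have : 0 ≤ v / p ^ (n + 1) := div_nonneg hv (by positivity)
  linarith

/-- A finite form of the `q`-Vandermonde (Cauchy) identity. -/
theorem sum_cauchy {p : ℝ} (hp : 1 < p) (n : ℕ) : ∀ {v : ℝ}, 0 < v → v < p →
    ∑ k ∈ Finset.range (n + 1), v ^ k / (p ^ (k ^ 2) *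
      (shiftedPoch p 1 k * shiftedPoch p 1 (n - k) * shiftedPoch p v k)) =
      1 / (shiftedPoch p 1 n * shiftedPoch p v n) := by
  have hp0 : (0 : ℝ) < p := by linarith
  induction n with
  | zero => intro v hv hvp; simp
  | succ n ih =>
    intro v hv hvp
    have hvp' : v / p < p := (div_lt_self hv hp).trans hvp
    have h1 : (0 : ℝ) < 1 - 1 / p ^ (n + 1) := one_sub_div_pow_pos hp hp n
    have hv1 : (0 : ℝ) < 1 - v / p ^ (n + 1) := one_sub_div_pow_pos hp hvp n
    have hv0 : (0 : ℝ) < 1 - v / p := by simpa using one_sub_div_pow_pos hp hvp 0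
    have R1 := fun k => (shiftedPoch_pos hp hp k).ne'
    have Rv := fun k => (shiftedPoch_pos hp hvp k).ne'
    have Rv' := fun k => (shiftedPoch_pos hp hvp' k).ne'
    have hs : ∀ k, shiftedPoch p v (k + 1) = (1 - v / p) * shiftedPoch p (v / p) k := by
      intro k
      rw [add_comm, shiftedPoch_add]
      simp [shiftedPoch]
    set t : ℕ → ℝ := fun k => v ^ k / (p ^ (k ^ 2) *
      (shiftedPoch p 1 k * shiftedPoch p 1 (n + 1 - k) * shiftedPoch p v k)) with ht
    -- With `x = 1/p`, this is `1 - x^(n+1) = (1 - x^(n+1-k)) + x^(n+1-k) (1 - x^k)`. The first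
    -- piece cancels the last factor of `(1/p)_{n+1-k}` and leaves the case `n` for `v`. The second
    -- cancels the last factor of `(1/p)_k` and, after shifting `k`, leaves the case `n` for `v/p`;
    -- this is why `v` varies in the induction.
    have split : (1 - 1 / p ^ (n + 1)) * ∑ k ∈ Finset.range (n + 1 + 1), t k =
        ∑ k ∈ Finset.range (n + 1 + 1), (1 - 1 / p ^ (n + 1 - k)) * t k +
        ∑ k ∈ Finset.range (n + 1 + 1), 1 / p ^ (n + 1 - k) * (1 - 1 / p ^ k) * t k := by
      rw [Finset.mul_sum, ← Finset.sum_add_distrib]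
      refine Finset.sum_congr rfl fun k hk => ?_
      have hk' : k ≤ n + 1 := Nat.lt_succ_iff.mp (Finset.mem_range.mp hk)
      have : (p : ℝ) ^ (n + 1) = p ^ (n + 1 - k) * p ^ k := by
        rw [← pow_add, Nat.sub_add_cancel hk']
      rw [this]
      field_simp
      ring
    have first : ∑ k ∈ Finset.range (n + 1 + 1), (1 - 1 / p ^ (n + 1 - k)) * t k =
        1 / (shiftedPoch p 1 n * shiftedPoch p v n) := by
      rw [Finset.sum_range_succ, ← ih hv hvp]
      simp only [Nat.sub_self, pow_zero, div_one, sub_self, zero_mul, add_zero]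
      refine Finset.sum_congr rfl fun k hk => ?_
      have hk' : k ≤ n := Nat.lt_succ_iff.mp (Finset.mem_range.mp hk)
      have e : n + 1 - k = n - k + 1 := by omega
      have h2 : (0 : ℝ) < 1 - 1 / p ^ (n - k + 1) := one_sub_div_pow_pos hp hp _
      simp only [ht, e, shiftedPoch_succ p 1 (n - k)]
      rw [mul_div_assoc', div_eq_div_iff]
      · ring
      · have := R1 k; have := R1 (n - k); have := Rv k; have := h2.ne'; positivity
      · have := R1 k; have := R1 (n - k); have := Rv k; positivity
    have second : ∑ k ∈ Finset.range (n + 1 + 1), 1 / p ^ (n + 1 - k) * (1 - 1 / p ^ k) * t k =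
        v / (p ^ (n + 1) * (1 - v / p)) *
          (1 / (shiftedPoch p 1 n * shiftedPoch p (v / p) n)) := by
      rw [Finset.sum_range_succ', ← ih (by positivity) hvp', Finset.mul_sum]
      simp only [pow_zero, div_one, sub_self, mul_zero, zero_mul, add_zero]
      refine Finset.sum_congr rfl fun k hk => ?_
      have hk' : k ≤ n := Nat.lt_succ_iff.mp (Finset.mem_range.mp hk)
      have e : n + 1 - (k + 1) = n - k := by omega
      have h2 : (0 : ℝ) < 1 - 1 / p ^ (k + 1) := one_sub_div_pow_pos hp hp _
      have hpn : (p : ℝ) ^ (n + 1) = p ^ (n - k) * p ^ (k + 1) := by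
        rw [← pow_add]; congr 1; omega
      simp only [ht, e, shiftedPoch_succ p 1 k, hs, hpn]
      have := R1 k; have := R1 (n - k); have := Rv' k; have := h2.ne'; have := hv0.ne'
      have hsq : (p : ℝ) ^ ((k + 1) ^ 2) = p ^ (k ^ 2) * p ^ k * p ^ (k + 1) := by
        rw [← pow_add, ← pow_add]; congr 1; ring
      rw [hsq, div_pow]
      generalize shiftedPoch p 1 k = a at *
      generalize shiftedPoch p 1 (n - k) = b at *
      generalize shiftedPoch p (v / p) k = c at *
      generalize (1 - 1 / p ^ (k + 1) : ℝ) = d at *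
      generalize (1 - v / p : ℝ) = f at *
      field_simp
      ring
    rw [first, second] at split
    have e1 : shiftedPoch p v (n + 1) = (1 - v / p) * shiftedPoch p (v / p) n := hs n
    have e2 := shiftedPoch_succ p v n
    have e3 : v / (p ^ (n + 1) * (1 - v / p)) *
          (1 / (shiftedPoch p 1 n * shiftedPoch p (v / p) n)) =
        v / p ^ (n + 1) / (shiftedPoch p 1 n * shiftedPoch p v (n + 1)) := by
      rw [e1]
      have := R1 n; have := Rv' n; have := hv0.ne'
      generalize (1 - v / p : ℝ) = f at *
      field_simp
    rw [e3] at split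
    have e4 : 1 / (shiftedPoch p 1 n * shiftedPoch p v n) =
        (1 - v / p ^ (n + 1)) / (shiftedPoch p 1 n * shiftedPoch p v (n + 1)) := by
      rw [e2]
      have := R1 n; have := Rv n; have := hv1.ne'
      generalize (1 - v / p ^ (n + 1) : ℝ) = f at *
      field_simp
    rw [e4, ← add_div, sub_add_cancel] at split
    rw [shiftedPoch_succ p 1 n]
    have := R1 n; have := Rv (n + 1); have := h1.ne'
    rw [eq_div_iff (by positivity)]
    rw [eq_div_iff (by positivity)] at split
    linear_combination split

/-- The mass of the diagrams with `a` rows, weighted by surjections to a diagram with `s` rows. -/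
def rankWeight (p u : ℝ) (s a : ℕ) : ℝ :=
  if s ≤ a then u ^ (a - s) / (p ^ (a * (a - s)) * (shiftedPoch p 1 (a - s) * shiftedPoch p u a))
  else 0

theorem rankWeight_nonneg {p u : ℝ} (hp : 1 < p) (hu : 0 < u) (hup : u < p) (s a : ℕ) :
    0 ≤ rankWeight p u s a := by
  have := (shiftedPoch_pos hp hp (a - s)).le
  have := (shiftedPoch_pos hp hup a).le
  rw [rankWeight]
  split_ifs <;> positivity

/-- Terms with `b < t` vanish; the substitution `b = t + k` turns the rest into `sum_cauchy` with `n
= a - t` and `v = u/p^t`. -/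
theorem sum_rankWeight {p u : ℝ} (hp : 1 < p) (hu : 0 < u) (hup : u < p) (t a : ℕ) :
    ∑ b ∈ Finset.range (a + 1), rankWeight p u t b / shiftedPoch p 1 (a - b) =
      if t ≤ a then 1 / (shiftedPoch p 1 (a - t) * shiftedPoch p u a) else 0 := by
  split_ifs with h
  · obtain ⟨n, rfl⟩ := Nat.exists_eq_add_of_le h
    have hv : 0 < u / p ^ t := by positivity
    have hvp : u / p ^ t < p := (div_le_self hu.le (one_le_pow₀ hp.le)).trans_lt hup
    rw [add_assoc, Finset.sum_range_add, Finset.sum_eq_zero, zero_add, Nat.add_sub_cancel_left,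
      shiftedPoch_add, mul_left_comm, ← one_div_mul_one_div, ← sum_cauchy hp n hv hvp,
      Finset.mul_sum]
    · refine Finset.sum_congr rfl fun k _ => ?_
      rw [rankWeight, if_pos (Nat.le_add_right t k), Nat.add_sub_cancel_left, shiftedPoch_add,
        Nat.add_sub_add_left, div_pow, ← pow_mul, add_mul, pow_add, ← sq]
      have := (shiftedPoch_pos hp hp k).ne'
      have := (shiftedPoch_pos hp hp (n - k)).ne'
      have := (shiftedPoch_pos hp hup t).ne'
      have := (shiftedPoch_pos hp hvp k).ne'
      field_simp
    · intro b hb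
      rw [rankWeight, if_neg (not_le.mpr (Finset.mem_range.mp hb)), zero_div]
  · refine Finset.sum_eq_zero fun b hb => ?_
    have := Finset.mem_range.mp hb
    rw [rankWeight, if_neg (by omega), zero_div]

/-! ### Removing and prepending a first column. -/

/-- The diagram obtained by removing the first column. -/
def dropCol (lam : YoungDiagram) : YoungDiagram where
  cells := lam.cells.preimage (Prod.map id Nat.succ)
    ((Function.injective_id.prodMap Nat.succ_injective).injOn)
  isLowerSet := by
    intro a b hab ha
    simp only [Finset.coe_preimage, Set.mem_preimage, Finset.mem_coe] at ha ⊢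
    exact lam.isLowerSet (a := Prod.map id Nat.succ a)
      ⟨hab.1, Nat.succ_le_succ hab.2⟩ ha

theorem mem_dropCol {lam : YoungDiagram} {i j : ℕ} : (i, j) ∈ dropCol lam ↔ (i, j + 1) ∈ lam := by
  rw [← YoungDiagram.mem_cells, ← YoungDiagram.mem_cells, dropCol, Finset.mem_preimage]
  rfl

/-- The diagram obtained by prepending a first column of length `a`. -/
def addCol (a : ℕ) (lam : YoungDiagram) (h : lam.colLen 0 ≤ a) : YoungDiagram where
  cells := Finset.range a ×ˢ {0} ∪ lam.cells.image (Prod.map id Nat.succ)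
  isLowerSet := by
    rintro ⟨i, j⟩ ⟨i', j'⟩ hab ha
    obtain ⟨hi, hj⟩ : i' ≤ i ∧ j' ≤ j := hab
    simp only [Finset.coe_union, Finset.coe_image, Set.mem_union, Finset.mem_coe,
      Finset.mem_product, Finset.mem_range, Finset.mem_singleton, Set.mem_image, Prod.exists,
      Prod.map_apply, id, Prod.mk.injEq, YoungDiagram.mem_cells] at ha ⊢
    rcases ha with ⟨h1, rfl⟩ | ⟨x, y, hxy, rfl, rfl⟩
    · exact Or.inl ⟨by omega, by omega⟩
    · rcases j' with _ | j'
      · refine Or.inl ⟨?_, rfl⟩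
        have : x < lam.colLen 0 :=
          YoungDiagram.mem_iff_lt_colLen.mp (lam.up_left_mem le_rfl (Nat.zero_le y) hxy)
        omega
      · exact Or.inr ⟨i', j', lam.up_left_mem hi (by omega) hxy, rfl, rfl⟩

theorem mem_addCol {a : ℕ} {lam : YoungDiagram} {h : lam.colLen 0 ≤ a} {i j : ℕ} :
    (i, j) ∈ addCol a lam h ↔ (i < a ∧ j = 0) ∨ ∃ k, j = k + 1 ∧ (i, k) ∈ lam := by
  rw [← YoungDiagram.mem_cells, addCol]
  simp only [Finset.mem_union, Finset.mem_product, Finset.mem_range, Finset.mem_singleton,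
    Finset.mem_image, Prod.exists, Prod.map_apply, id, Prod.mk.injEq, YoungDiagram.mem_cells]
  constructor
  · rintro (h | ⟨x, y, hxy, rfl, rfl⟩)
    · exact Or.inl h
    · exact Or.inr ⟨y, rfl, hxy⟩
  · rintro (h | ⟨k, rfl, hk⟩)
    · exact Or.inl h
    · exact Or.inr ⟨i, k, hk, rfl, rfl⟩

theorem eq_of_colLen_eq {lam mu : YoungDiagram} (h : ∀ j, lam.colLen j = mu.colLen j) :
    lam = mu := by
  ext ⟨i, j⟩
  rw [YoungDiagram.mem_cells, YoungDiagram.mem_cells, YoungDiagram.mem_iff_lt_colLen,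
    YoungDiagram.mem_iff_lt_colLen, h]

@[simp] theorem colLen_dropCol (lam : YoungDiagram) (j : ℕ) :
    (dropCol lam).colLen j = lam.colLen (j + 1) := by
  refine eq_of_forall_lt_iff fun i => ?_
  rw [← YoungDiagram.mem_iff_lt_colLen, mem_dropCol, YoungDiagram.mem_iff_lt_colLen]

@[simp] theorem rowLen_dropCol (lam : YoungDiagram) (i : ℕ) :
    (dropCol lam).rowLen i = lam.rowLen i - 1 := by
  refine eq_of_forall_lt_iff fun j => ?_
  rw [← YoungDiagram.mem_iff_lt_rowLen, mem_dropCol, YoungDiagram.mem_iff_lt_rowLen]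
  omega

@[simp] theorem colLen_zero_addCol (a : ℕ) (lam : YoungDiagram) (h : lam.colLen 0 ≤ a) :
    (addCol a lam h).colLen 0 = a := by
  refine eq_of_forall_lt_iff fun i => ?_
  rw [← YoungDiagram.mem_iff_lt_colLen, mem_addCol]
  simp

@[simp] theorem dropCol_addCol (a : ℕ) (lam : YoungDiagram) (h : lam.colLen 0 ≤ a) :
    dropCol (addCol a lam h) = lam := by
  ext ⟨i, j⟩
  rw [YoungDiagram.mem_cells, YoungDiagram.mem_cells, mem_dropCol, mem_addCol]
  simp

theorem colLen_zero_dropCol_le (lam : YoungDiagram) : (dropCol lam).colLen 0 ≤ lam.colLen 0 := by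
  rw [colLen_dropCol]
  exact lam.colLen_anti _ _ (Nat.zero_le _)

theorem addCol_dropCol {a : ℕ} {lam : YoungDiagram} (ha : lam.colLen 0 = a)
    (h : (dropCol lam).colLen 0 ≤ a) : addCol a (dropCol lam) h = lam := by
  refine eq_of_colLen_eq fun j => ?_
  rcases j with _ | j
  · rw [colLen_zero_addCol, ha]
  · rw [← colLen_dropCol, dropCol_addCol, colLen_dropCol]

/-- Removing the first column is a bijection from the diagrams with first column of length `a`
to the diagrams with at most `a` rows. -/
def dropColEquiv (a : ℕ) :
    {lam : YoungDiagram // lam.colLen 0 = a} ≃ {lam : YoungDiagram // lam.colLen 0 ≤ a} where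
  toFun lam := ⟨dropCol lam, (colLen_zero_dropCol_le _).trans lam.2.le⟩
  invFun lam := ⟨addCol a lam lam.2, colLen_zero_addCol _ _ _⟩
  left_inv lam := Subtype.ext (addCol_dropCol lam.2 ((colLen_zero_dropCol_le _).trans lam.2.le))
  right_inv lam := Subtype.ext (dropCol_addCol a lam lam.2)

theorem card_eq_colLen_add_card_dropCol (lam : YoungDiagram) :
    lam.card = lam.colLen 0 + (dropCol lam).card := by
  have h := addCol_dropCol rfl (colLen_zero_dropCol_le lam)
  conv_lhs => rw [← h]
  rw [YoungDiagram.card, addCol, Finset.card_union_of_disjoint, Finset.card_product,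
    Finset.card_range, Finset.card_singleton, mul_one, Finset.card_image_of_injective]
  · exact Function.injective_id.prodMap Nat.succ_injective
  · rw [Finset.disjoint_left]
    rintro ⟨i, j⟩ h1 h2
    simp only [Finset.mem_product, Finset.mem_singleton, Finset.mem_image, Prod.exists,
      Prod.map_apply, Prod.mk.injEq] at h1 h2
    obtain ⟨x, y, -, -, rfl⟩ := h2
    exact Nat.succ_ne_zero _ h1.2

@[simp] theorem colLen_bot (j : ℕ) : (⊥ : YoungDiagram).colLen j = 0 := by
  refine Nat.eq_zero_of_not_pos fun h => ?_
  exact YoungDiagram.notMem_bot _ (YoungDiagram.mem_iff_lt_colLen.mpr h)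

@[simp] theorem rowLen_bot (j : ℕ) : (⊥ : YoungDiagram).rowLen j = 0 := by
  refine Nat.eq_zero_of_not_pos fun h => ?_
  exact YoungDiagram.notMem_bot _ (YoungDiagram.mem_iff_lt_rowLen.mpr h)

@[simp] theorem dropCol_bot : dropCol ⊥ = ⊥ := eq_of_colLen_eq fun j => by simp

theorem eq_bot_of_rowLen_zero {lam : YoungDiagram} (h : lam.rowLen 0 = 0) : lam = ⊥ := by
  ext ⟨i, j⟩
  rw [YoungDiagram.mem_cells, YoungDiagram.mem_iff_lt_rowLen]
  have := lam.rowLen_anti 0 i (Nat.zero_le _)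
  simp
  omega

theorem eq_bot_of_colLen_zero {lam : YoungDiagram} (h : lam.colLen 0 = 0) : lam = ⊥ := by
  refine eq_of_colLen_eq fun j => ?_
  have := lam.colLen_anti 0 j (Nat.zero_le _)
  rw [colLen_bot]
  omega

/-- Induction on the number of columns. -/
theorem dropCol_induction {motive : YoungDiagram → Prop} (bot : motive ⊥)
    (step : ∀ lam, motive (dropCol lam) → motive lam) (lam : YoungDiagram) : motive lam := by
  induction h : lam.rowLen 0 generalizing lam with
  | zero => rwa [eq_bot_of_rowLen_zero h]
  | succ n ih => exact step _ (ih _ (by simp [h]))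

/-! ### Automorphism numbers in terms of columns. -/

theorem lt_colLen_iff_lt_rowLen {lam : YoungDiagram} {i j : ℕ} :
    i < lam.colLen j ↔ j < lam.rowLen i := by
  rw [← YoungDiagram.mem_iff_lt_colLen, YoungDiagram.mem_iff_lt_rowLen]

/-- A row has length exactly `j + 1` when it meets column `j` but not column `j + 1`. -/
theorem multiplicity_succ (lam : YoungDiagram) (j : ℕ) :
    multiplicity lam (j + 1) = lam.colLen j - lam.colLen (j + 1) := by
  have h : ((Finset.range (lam.colLen 0)).filter fun k => lam.rowLen k = j + 1) =
      Finset.Ico (lam.colLen (j + 1)) (lam.colLen j) := by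
    ext k
    simp only [Finset.mem_filter, Finset.mem_range, Finset.mem_Ico]
    rw [← not_lt, lt_colLen_iff_lt_rowLen, lt_colLen_iff_lt_rowLen, lt_colLen_iff_lt_rowLen]
    omega
  rw [← Nat.card_Ico, ← h, multiplicity, YoungDiagram.rowLens, List.count_eq_countP,
    List.countP_map, List.countP_eq_length_filter, Finset.card_def]
  simp [Finset.range, Multiset.range, Function.comp_def, beq_eq_decide]

theorem autCard_eq (p : ℝ) (lam : YoungDiagram) :
    autCard p lam = p ^ (∑ j ∈ Finset.range (lam.rowLen 0), lam.colLen j ^ 2) *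
      ∏ j ∈ Finset.range (lam.rowLen 0),
        shiftedPoch p 1 (lam.colLen j - lam.colLen (j + 1)) := by
  rw [autCard]
  congr 1
  rw [← Finset.Ico_succ_right_eq_Icc, Finset.prod_Ico_eq_prod_range]
  refine Finset.prod_congr rfl fun j _ => ?_
  rw [add_comm, multiplicity_succ, poch_div_natCast]

@[simp] theorem autCard_bot (p : ℝ) : autCard p ⊥ = 1 := by simp [autCard_eq]

theorem autCard_eq_dropCol (p : ℝ) (lam : YoungDiagram) :
    autCard p lam = p ^ (lam.colLen 0 ^ 2) * shiftedPoch p 1 (lam.colLen 0 - lam.colLen 1) *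
      autCard p (dropCol lam) := by
  rcases h : lam.rowLen 0 with _ | n
  · simp [eq_bot_of_rowLen_zero h]
  · rw [autCard_eq, autCard_eq, h, rowLen_dropCol, h, Nat.add_sub_cancel, Finset.sum_range_succ',
      Finset.prod_range_succ', pow_add]
    simp only [colLen_dropCol]
    ring

theorem autCard_pos {p : ℝ} (hp : 1 < p) (lam : YoungDiagram) : 0 < autCard p lam := by
  rw [autCard_eq]
  exact mul_pos (by positivity) (Finset.prod_pos fun _ _ => shiftedPoch_pos hp hp _)

/-! ### The product formula for injections, at real `p`. -/

/-- The polynomial counting injective homomorphisms from a group of type `mu` to one of type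
`lam`. -/
def injPoly (lam mu : YoungDiagram) : ℤ[X] :=
  ∏ i ∈ Finset.range (mu.colLen 0), X ^ (∑ j ∈ Finset.range (mu.rowLen i - 1), lam.colLen j) *
    (X ^ lam.colLen (mu.rowLen i - 1) - X ^ i)

/-- The value at `p` of the polynomial counting injective homomorphisms. -/
def injCard (p : ℝ) (lam mu : YoungDiagram) : ℝ :=
  ∏ i ∈ Finset.range (mu.colLen 0), p ^ (∑ j ∈ Finset.range (mu.rowLen i - 1), lam.colLen j) *
    (p ^ lam.colLen (mu.rowLen i - 1) - p ^ i)

@[simp] theorem injCard_bot (p : ℝ) (lam : YoungDiagram) : injCard p lam ⊥ = 1 := by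
  simp [injCard]

/-- The parts of `mu` equal to `1` are the rows from `mu.colLen 1` up to `mu.colLen 0`; their
exponent sum is empty. Each longer row splits off one factor `p ^ lam.colLen 0` and leaves its
factor for the shortened diagrams. -/
theorem injCard_eq_dropCol (p : ℝ) (lam mu : YoungDiagram) :
    injCard p lam mu = p ^ (lam.colLen 0 * mu.colLen 1) *
      (∏ i ∈ Finset.Ico (mu.colLen 1) (mu.colLen 0), (p ^ lam.colLen 0 - p ^ i)) *
        injCard p (dropCol lam) (dropCol mu) := by
  rw [injCard, ← Finset.prod_range_mul_prod_Ico _ (mu.colLen_anti 0 1 zero_le_one)]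
  have h1 : ∏ i ∈ Finset.Ico (mu.colLen 1) (mu.colLen 0),
      p ^ (∑ j ∈ Finset.range (mu.rowLen i - 1), lam.colLen j) *
        (p ^ lam.colLen (mu.rowLen i - 1) - p ^ i) =
      ∏ i ∈ Finset.Ico (mu.colLen 1) (mu.colLen 0), (p ^ lam.colLen 0 - p ^ i) := by
    refine Finset.prod_congr rfl fun i hi => ?_
    rw [Finset.mem_Ico, ← not_lt, lt_colLen_iff_lt_rowLen, lt_colLen_iff_lt_rowLen] at hi
    rw [show mu.rowLen i - 1 = 0 by omega]
    simp
  have h2 : ∏ i ∈ Finset.range (mu.colLen 1),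
      p ^ (∑ j ∈ Finset.range (mu.rowLen i - 1), lam.colLen j) *
        (p ^ lam.colLen (mu.rowLen i - 1) - p ^ i) =
      p ^ (lam.colLen 0 * mu.colLen 1) * injCard p (dropCol lam) (dropCol mu) := by
    rw [injCard, pow_mul, ← Finset.card_range (mu.colLen 1), ← Finset.prod_const,
      Finset.card_range, colLen_dropCol, zero_add, ← Finset.prod_mul_distrib]
    refine Finset.prod_congr rfl fun i hi => ?_
    rw [Finset.mem_range, lt_colLen_iff_lt_rowLen] at hi
    simp only [colLen_dropCol, rowLen_dropCol]
    obtain ⟨n, hn⟩ : ∃ n, mu.rowLen i = n + 2 := ⟨mu.rowLen i - 2, by omega⟩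
    rw [hn]
    simp only [Nat.add_sub_cancel, Nat.add_succ_sub_one]
    rw [Finset.sum_range_succ', pow_add]
    ring
  rw [h1, h2]
  ring

theorem prod_Ico_pow_sub_pow {p : ℝ} (hp : 1 < p) {a s t : ℕ} (hts : t ≤ s) (hsa : s ≤ a) :
    ∏ i ∈ Finset.Ico t s, (p ^ a - p ^ i) =
      p ^ (a * (s - t)) * shiftedPoch p 1 (a - t) / shiftedPoch p 1 (a - s) := by
  rw [eq_div_iff (shiftedPoch_pos hp hp _).ne']
  induction s, hts using Nat.le_induction with
  | base => simp
  | succ s hts ih =>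
    have e : a - s = a - (s + 1) + 1 := by omega
    have e2 : s + 1 - t = s - t + 1 := by omega
    have e3 : (p : ℝ) ^ a = p ^ s * p ^ (a - (s + 1) + 1) := by
      rw [← pow_add]; congr 1; omega
    have ih' := ih (by omega)
    rw [e, shiftedPoch_succ] at ih'
    rw [Finset.prod_Ico_succ_top hts, e2, mul_add, mul_one, pow_add]
    have h0 : (p : ℝ) ^ a - p ^ s = p ^ a * (1 - 1 / p ^ (a - (s + 1) + 1)) := by
      rw [e3]
      have : (p : ℝ) ≠ 0 := by positivity
      field_simp
    rw [h0]
    linear_combination p ^ a * ih'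

theorem prod_Ico_pow_sub_pow_eq_zero (p : ℝ) {a s t : ℕ} (hta : t ≤ a) (has : a < s) :
    ∏ i ∈ Finset.Ico t s, (p ^ a - p ^ i) = 0 :=
  Finset.prod_eq_zero (Finset.mem_Ico.mpr ⟨hta, has⟩) (sub_self _)

theorem injCard_self {p : ℝ} (hp : 1 < p) (mu : YoungDiagram) :
    injCard p mu mu = autCard p mu := by
  induction mu using dropCol_induction with
  | bot => simp
  | step mu ih =>
    have h := mu.colLen_anti 0 1 zero_le_one
    rw [injCard_eq_dropCol, autCard_eq_dropCol, ih, prod_Ico_pow_sub_pow hp h le_rfl,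
      Nat.sub_self, shiftedPoch_zero, div_one, ← mul_assoc, ← pow_add, ← mul_add,
      Nat.add_sub_of_le h, sq]

theorem injCard_eq_zero_of_colLen_lt (p : ℝ) {lam mu : YoungDiagram}
    (h : lam.colLen 0 < mu.colLen 0) : injCard p lam mu = 0 := by
  induction mu using dropCol_induction generalizing lam with
  | bot => simp at h
  | step mu ih =>
    rw [injCard_eq_dropCol]
    rcases le_or_gt (mu.colLen 1) (lam.colLen 0) with h1 | h1
    · rw [prod_Ico_pow_sub_pow_eq_zero p h1 h, mul_zero, zero_mul]
    · rw [ih, mul_zero]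
      have := colLen_zero_dropCol_le lam
      rw [colLen_dropCol mu, zero_add]
      omega

/-- Single factors can be negative, but only when `mu` has more rows than `lam` at some stage of the
column recursion, and then another factor is zero. -/
theorem injCard_nonneg {p : ℝ} (hp : 1 < p) (lam mu : YoungDiagram) : 0 ≤ injCard p lam mu := by
  induction mu using dropCol_induction generalizing lam with
  | bot => simp
  | step mu ih =>
    rcases lt_or_ge (lam.colLen 0) (mu.colLen 0) with h | h
    · exact (injCard_eq_zero_of_colLen_lt p h).ge
    · rw [injCard_eq_dropCol, prod_Ico_pow_sub_pow hp (mu.colLen_anti 0 1 zero_le_one) h]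
      have := (shiftedPoch_pos hp hp (lam.colLen 0 - mu.colLen 1)).le
      have := (shiftedPoch_pos hp hp (lam.colLen 0 - mu.colLen 0)).le
      have := ih (dropCol lam)
      positivity

/-! ### Infinite products -/

theorem poch_top_eq (p v : ℝ) : poch p (v / p) ⊤ = ∏' i : ℕ, (1 + -(v / p * (1 / p) ^ i)) := by
  rw [poch, if_pos rfl]
  refine tprod_congr fun i => ?_
  rw [one_div, inv_pow, ← div_eq_mul_inv, sub_eq_add_neg]

theorem summable_norm_geometric {p : ℝ} (hp : 1 < p) (v : ℝ) :
    Summable fun i : ℕ => ‖-(v / p * (1 / p) ^ i)‖ := by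
  have h : Summable fun i : ℕ => v / p * (1 / p) ^ i :=
    (summable_geometric_of_lt_one (by positivity)
      ((div_lt_one (by linarith)).mpr hp)).mul_left _
  simpa only [norm_neg] using h.norm

theorem tendsto_shiftedPoch {p : ℝ} (hp : 1 < p) (v : ℝ) :
    Tendsto (shiftedPoch p v) atTop (𝓝 (poch p (v / p) ⊤)) := by
  rw [poch_top_eq]
  have h := (multipliable_one_add_of_summable (summable_norm_geometric hp v)).hasProd.tendsto_prod_nat
  refine h.congr fun n => Finset.prod_congr rfl fun i _ => ?_
  rw [one_div, inv_pow, ← div_eq_mul_inv, ← sub_eq_add_neg, div_div, pow_succ']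

/-- For `d = ∞` the limit of positive products is nonnegative, and an absolutely convergent product
of nonzero factors is nonzero. -/
theorem poch_pos {p v : ℝ} (hp : 1 < p) (hvp : v < p) (d : ℕ∞) : 0 < poch p (v / p) d := by
  induction d with
  | top =>
    refine lt_of_le_of_ne (ge_of_tendsto' (tendsto_shiftedPoch hp v)
      fun n => (shiftedPoch_pos hp hvp n).le) (Ne.symm ?_)
    rw [poch_top_eq]
    refine tprod_one_add_ne_zero_of_summable (fun i => ?_) (summable_norm_geometric hp v)
    have := (one_sub_div_pow_pos hp hvp i).ne'
    rwa [one_div, inv_pow, ← div_eq_mul_inv, ← sub_eq_add_neg, div_div, ← pow_succ']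
  | coe n => rw [poch_div_natCast]; exact shiftedPoch_pos hp hvp n

theorem poch_top_le {p v : ℝ} (hp : 1 < p) (hv : 0 ≤ v) (hvp : v < p) (n : ℕ) :
    poch p (v / p) ⊤ ≤ shiftedPoch p v n :=
  (shiftedPoch_antitone hp hv hvp).le_of_tendsto (tendsto_shiftedPoch hp v) n

/-! ### Sums over diagrams -/

/-- The weight `u^|lam| |Inj(mu, lam)| / |Aut(lam)|`. -/
def surWeight (p u : ℝ) (lam mu : YoungDiagram) : ℝ :=
  u ^ lam.card * injCard p lam mu / autCard p lam

theorem surWeight_nonneg {p u : ℝ} (hp : 1 < p) (hu : 0 < u) (lam mu : YoungDiagram) :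
    0 ≤ surWeight p u lam mu := by
  have := injCard_nonneg hp lam mu
  have := autCard_pos hp lam
  rw [surWeight]
  positivity

/-- The factor relating the weights before and after removal of the first columns, where the
first columns have lengths `a` and `s`, and the second column of `mu` has length `t`. -/
def colFactor (p u : ℝ) (a s t : ℕ) : ℝ :=
  u ^ a * p ^ (a * t) * (∏ i ∈ Finset.Ico t s, (p ^ a - p ^ i)) / p ^ (a ^ 2)

theorem surWeight_eq_dropCol {p u : ℝ} (hp : 1 < p) (lam mu : YoungDiagram) :
    surWeight p u lam mu = colFactor p u (lam.colLen 0) (mu.colLen 0) (mu.colLen 1) *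
      (1 / shiftedPoch p 1 (lam.colLen 0 - (dropCol lam).colLen 0) *
        surWeight p u (dropCol lam) (dropCol mu)) := by
  have h1 := (autCard_pos hp (dropCol lam)).ne'
  have h2 := (shiftedPoch_pos hp hp (lam.colLen 0 - lam.colLen 1)).ne'
  rw [surWeight, surWeight, colFactor, card_eq_colLen_add_card_dropCol, injCard_eq_dropCol,
    autCard_eq_dropCol, colLen_dropCol, zero_add, pow_add]
  field_simp

/-- The closed form satisfies the recursion that column removal imposes on the rank sums:
`sum_rankWeight` evaluates the inner sum, and its factor `(1/p)_{a-t}` cancels against the product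
in `colFactor`. -/
theorem rankWeight_eq_colFactor_mul {p u : ℝ} (hp : 1 < p) (hu : 0 < u) (hup : u < p) {s t : ℕ}
    (hts : t ≤ s) (a : ℕ) :
    u ^ s * rankWeight p u s a = colFactor p u a s t *
      ∑ b ∈ Finset.range (a + 1), 1 / shiftedPoch p 1 (a - b) * rankWeight p u t b := by
  have hsum := sum_rankWeight hp hu hup t a
  simp only [div_eq_inv_mul (rankWeight p u t _), ← one_div (shiftedPoch p 1 _)] at hsum
  rw [hsum]
  rcases lt_or_ge a s with has | hsa
  · rw [rankWeight, if_neg (not_le.mpr has), mul_zero]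
    split_ifs with hta
    · rw [colFactor, prod_Ico_pow_sub_pow_eq_zero p hta has]
      simp
    · rw [mul_zero]
  · rw [if_pos (hts.trans hsa), rankWeight, if_pos hsa, colFactor,
      prod_Ico_pow_sub_pow hp hts hsa]
    have h1 := (shiftedPoch_pos hp hp (a - s)).ne'
    have h2 := (shiftedPoch_pos hp hp (a - t)).ne'
    have h3 := (shiftedPoch_pos hp hup a).ne'
    have h4 : (p : ℝ) ^ (a ^ 2) = p ^ (a * (a - s)) * p ^ (a * t) * p ^ (a * (s - t)) := by
      rw [← pow_add, ← pow_add, ← mul_add, ← mul_add, sq]; congr 2; omega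
    have h5 : u ^ a = u ^ s * u ^ (a - s) := by rw [← pow_add]; congr 1; omega
    rw [h4, h5]
    field_simp

theorem tsum_colLen_eq_dropCol (F : YoungDiagram → ℝ≥0∞) (a : ℕ) :
    ∑' lam : {lam : YoungDiagram // lam.colLen 0 = a}, F (dropCol lam) =
      ∑ b ∈ Finset.range (a + 1), ∑' lam : {lam : YoungDiagram // lam.colLen 0 = b}, F lam := by
  have h := (dropColEquiv a).tsum_eq fun lam => F lam
  have h2 : ∀ b, ∑' lam : {lam : YoungDiagram // lam.colLen 0 = b}, F lam =
      ∑' lam, Set.indicator {lam : YoungDiagram | lam.colLen 0 = b} F lam :=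
    fun b => tsum_subtype {lam : YoungDiagram | lam.colLen 0 = b} F
  refine h.trans ((tsum_subtype {lam : YoungDiagram | lam.colLen 0 ≤ a} F).trans ?_)
  simp only [h2]
  rw [← Summable.tsum_finsetSum fun _ _ => ENNReal.summable]
  refine tsum_congr fun lam => ?_
  simp only [Set.indicator_apply, Set.mem_ofPred_eq]
  rw [Finset.sum_ite_eq]
  simp

theorem tsum_eq_tsum_colLen (F : YoungDiagram → ℝ≥0∞) :
    ∑' lam, F lam = ∑' a, ∑' lam : {lam : YoungDiagram // lam.colLen 0 = a}, F lam := by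
  rw [← (Equiv.sigmaFiberEquiv fun lam : YoungDiagram => lam.colLen 0).tsum_eq F]
  exact ENNReal.tsum_sigma' _

/-- The sum of the weights of the diagrams satisfying `q` with first column of length `a`. -/
def rankSum (p u : ℝ) (q : YoungDiagram → Prop) [DecidablePred q] (mu : YoungDiagram) (a : ℕ) :
    ℝ≥0∞ :=
  ∑' lam : {lam : YoungDiagram // lam.colLen 0 = a},
    if q lam then ENNReal.ofReal (surWeight p u lam mu) else 0

/-- The recursion from `surWeight_eq_dropCol`, summed in `ℝ≥0∞` so that convergence is not yet
needed. The predicates allow truncation by the number of columns. -/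
theorem rankSum_eq_dropCol {p u : ℝ} (hp : 1 < p) (hu : 0 < u) (q r : YoungDiagram → Prop)
    [DecidablePred q] [DecidablePred r] (hqr : ∀ lam, q lam ↔ r (dropCol lam))
    (mu : YoungDiagram) (a : ℕ) :
    rankSum p u q mu a = ENNReal.ofReal (colFactor p u a (mu.colLen 0) (mu.colLen 1)) *
      ∑ b ∈ Finset.range (a + 1),
        ENNReal.ofReal (1 / shiftedPoch p 1 (a - b)) * rankSum p u r (dropCol mu) b := by
  have h := tsum_colLen_eq_dropCol (fun lam =>
    ENNReal.ofReal (1 / shiftedPoch p 1 (a - lam.colLen 0)) *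
      if r lam then ENNReal.ofReal (surWeight p u lam (dropCol mu)) else 0) a
  have h2 : ∑ b ∈ Finset.range (a + 1),
        ENNReal.ofReal (1 / shiftedPoch p 1 (a - b)) * rankSum p u r (dropCol mu) b =
      ∑' lam : {lam : YoungDiagram // lam.colLen 0 = a},
        ENNReal.ofReal (1 / shiftedPoch p 1 (a - (dropCol lam).colLen 0)) *
        if r (dropCol lam) then
          ENNReal.ofReal (surWeight p u (dropCol lam) (dropCol mu)) else 0 := by
    rw [h]
    refine Finset.sum_congr rfl fun b _ => ?_
    rw [rankSum, ← ENNReal.tsum_mul_left]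
    exact tsum_congr fun lam => by rw [lam.2]
  rw [h2, rankSum, ← ENNReal.tsum_mul_left]
  refine tsum_congr fun lam => ?_
  simp only [hqr]
  split_ifs
  · have h3 := surWeight_nonneg hp hu (dropCol lam) (dropCol mu)
    have h4 := (shiftedPoch_pos hp hp (a - (dropCol lam.1).colLen 0)).le
    rw [surWeight_eq_dropCol hp, ENNReal.ofReal_mul' (by rw [lam.2]; positivity),
      ENNReal.ofReal_mul' h3, lam.2]
  · simp

theorem sum_ofReal_mul_ofReal {p u : ℝ} (hp : 1 < p) (hu : 0 < u) (hup : u < p) (t a : ℕ) {c : ℝ}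
    (hc : 0 ≤ c) :
    ∑ b ∈ Finset.range (a + 1), ENNReal.ofReal (1 / shiftedPoch p 1 (a - b)) *
        ENNReal.ofReal (c * rankWeight p u t b) =
      ENNReal.ofReal (c * ∑ b ∈ Finset.range (a + 1),
        1 / shiftedPoch p 1 (a - b) * rankWeight p u t b) := by
  have h1 := fun b => rankWeight_nonneg hp hu hup t b
  have h2 := fun b => (shiftedPoch_pos hp hp b).le
  rw [Finset.mul_sum, ENNReal.ofReal_sum_of_nonneg]
  · refine Finset.sum_congr rfl fun b _ => ?_
    have := h1 b
    rw [← ENNReal.ofReal_mul' (by positivity), mul_left_comm]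
  · intro b _
    have := h1 b
    have := h2 (a - b)
    positivity

/-- For `mu = ⊥` the recursion returns to `⊥`, so induction on `mu` is unavailable. Limiting the
number of columns makes it well founded, and the closed form, a fixed point, bounds every
truncation. -/
theorem rankSum_rowLen_le {p u : ℝ} (hp : 1 < p) (hu : 0 < u) (hup : u < p) (n a : ℕ) :
    rankSum p u (fun lam => lam.rowLen 0 ≤ n) ⊥ a ≤ ENNReal.ofReal (rankWeight p u 0 a) := by
  induction n generalizing a with
  | zero =>
    rcases a with _ | a
    · have : rankWeight p u 0 0 = 1 := by simp [rankWeight]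
      rw [this, rankSum, tsum_eq_single ⟨⊥, colLen_bot 0⟩]
      · simp [surWeight, YoungDiagram.card]
      · rintro ⟨lam, hl⟩ hne
        exact absurd (Subtype.ext (eq_bot_of_colLen_zero hl)) hne
    · rw [rankSum, ENNReal.tsum_eq_zero.mpr]
      · exact zero_le
      · rintro ⟨lam, hl⟩
        refine if_neg fun h : lam.rowLen 0 ≤ 0 => ?_
        rw [eq_bot_of_rowLen_zero (Nat.le_zero.mp h), colLen_bot] at hl
        omega
  | succ n ih =>
    have hqr : ∀ lam : YoungDiagram, lam.rowLen 0 ≤ n + 1 ↔ (dropCol lam).rowLen 0 ≤ n :=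
      fun lam => by rw [rowLen_dropCol]; omega
    have h := rankWeight_eq_colFactor_mul hp hu hup le_rfl (s := 0) a
    have hs := sum_ofReal_mul_ofReal hp hu hup 0 a zero_le_one
    simp only [one_mul] at hs
    rw [rankSum_eq_dropCol hp hu _ (fun lam => lam.rowLen 0 ≤ n) hqr, dropCol_bot, colLen_bot,
      colLen_bot, ← one_mul (rankWeight p u 0 a), ← pow_zero u, h, ENNReal.ofReal_mul, ← hs]
    · exact mul_le_mul_right (Finset.sum_le_sum fun b _ => mul_le_mul_right (ih b) _) _
    · simp only [colFactor, Finset.Ico_self, Finset.prod_empty]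
      positivity

theorem rankSum_bot_le {p u : ℝ} (hp : 1 < p) (hu : 0 < u) (hup : u < p) (a : ℕ) :
    rankSum p u (fun _ => True) ⊥ a ≤ ENNReal.ofReal (rankWeight p u 0 a) := by
  rw [rankSum, ENNReal.tsum_eq_iSup_sum]
  refine iSup_le fun s => ?_
  refine le_trans ?_ (rankSum_rowLen_le hp hu hup (s.sup fun lam => lam.1.rowLen 0) a)
  refine le_trans (Finset.sum_le_sum fun lam hl => ?_) (ENNReal.sum_le_tsum s)
  rw [if_pos trivial, if_pos (Finset.le_sup (f := fun lam => lam.1.rowLen 0) hl)]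

/-- The bound gives finiteness. Both sides then solve one real linear equation, in which the unknown
at `a` has coefficient `(u/p^a)^a < 1` for `a > 0`, so the solution is unique. For `a = 0` this
coefficient is `1`, and the empty diagram is treated directly. -/
theorem rankSum_bot {p u : ℝ} (hp : 1 < p) (hu : 0 < u) (hup : u < p) (a : ℕ) :
    rankSum p u (fun _ => True) ⊥ a = ENNReal.ofReal (rankWeight p u 0 a) := by
  induction a using Nat.strong_induction_on with
  | _ a ih =>
  rcases Nat.eq_zero_or_pos a with rfl | ha
  · refine le_antisymm (rankSum_bot_le hp hu hup 0) ?_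
    refine le_trans ?_ (ENNReal.le_tsum ⟨⊥, colLen_bot 0⟩)
    simp [rankWeight, surWeight, YoungDiagram.card]
  have hrec := rankSum_eq_dropCol hp hu (fun _ => True) (fun _ => True) (fun _ => Iff.rfl) ⊥ a
  rw [dropCol_bot, colLen_bot, colLen_bot, Finset.sum_range_succ, Nat.sub_self,
    shiftedPoch_zero, div_one, ENNReal.ofReal_one, one_mul] at hrec
  have hw := rankWeight_eq_colFactor_mul hp hu hup le_rfl (s := 0) a
  rw [pow_zero, one_mul, Finset.sum_range_succ, Nat.sub_self, shiftedPoch_zero, div_one,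
    one_mul] at hw
  have hfin : rankSum p u (fun _ => True) ⊥ a ≠ ∞ :=
    ne_top_of_le_ne_top ENNReal.ofReal_ne_top (rankSum_bot_le hp hu hup a)
  set g := (rankSum p u (fun _ => True) ⊥ a).toReal with hg
  have hgg : rankSum p u (fun _ => True) ⊥ a = ENNReal.ofReal g := (ENNReal.ofReal_toReal hfin).symm
  have hg0 : 0 ≤ g := ENNReal.toReal_nonneg
  have hsum : ∑ b ∈ Finset.range a, ENNReal.ofReal (1 / shiftedPoch p 1 (a - b)) *
      rankSum p u (fun _ => True) ⊥ b =
      ENNReal.ofReal (∑ b ∈ Finset.range a, 1 / shiftedPoch p 1 (a - b) * rankWeight p u 0 b) := by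
    have h0 : ∀ b, 0 ≤ 1 / shiftedPoch p 1 (a - b) * rankWeight p u 0 b := fun b => by
      have := rankWeight_nonneg hp hu hup 0 b
      have := (shiftedPoch_pos hp hp (a - b)).le
      positivity
    rw [ENNReal.ofReal_sum_of_nonneg fun b _ => h0 b]
    refine Finset.sum_congr rfl fun b hb => ?_
    rw [ih b (Finset.mem_range.mp hb), ← ENNReal.ofReal_mul' (rankWeight_nonneg hp hu hup 0 b)]
  set S := ∑ b ∈ Finset.range a, 1 / shiftedPoch p 1 (a - b) * rankWeight p u 0 b
  have hS0 : 0 ≤ S := Finset.sum_nonneg fun b _ => by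
    have := rankWeight_nonneg hp hu hup 0 b
    have := (shiftedPoch_pos hp hp (a - b)).le
    positivity
  have hc : colFactor p u a 0 0 = (u / p ^ a) ^ a := by
    rw [colFactor, Finset.Ico_self, Finset.prod_empty, div_pow, ← pow_mul, ← sq]
    simp
  have hc0 : 0 ≤ colFactor p u a 0 0 := by rw [hc]; positivity
  have hc1 : colFactor p u a 0 0 < 1 := by
    rw [hc]
    refine pow_lt_one₀ (by positivity) ?_ ha.ne'
    rw [div_lt_one (by positivity)]
    exact hup.trans_le (le_self_pow₀ hp.le ha.ne')
  rw [hsum, hgg, ← ENNReal.ofReal_add hS0 hg0, ← ENNReal.ofReal_mul hc0,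
    ENNReal.ofReal_eq_ofReal_iff hg0 (by positivity)] at hrec
  rw [hgg]
  congr 1
  -- The contributions `S` of smaller `b` agree by induction and cancel.
  have : (1 - colFactor p u a 0 0) * (g - rankWeight p u 0 a) = 0 := by
    linear_combination hrec - hw
  rcases mul_eq_zero.mp this with h | h <;> linarith

theorem rankSum_eq {p u : ℝ} (hp : 1 < p) (hu : 0 < u) (hup : u < p) (mu : YoungDiagram) (a : ℕ) :
    rankSum p u (fun _ => True) mu a =
      ENNReal.ofReal (u ^ mu.card * rankWeight p u (mu.colLen 0) a) := by
  induction mu using dropCol_induction generalizing a with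
  | bot => rw [rankSum_bot hp hu hup]; simp [YoungDiagram.card]
  | step mu ih =>
    have h := rankWeight_eq_colFactor_mul hp hu hup (mu.colLen_anti 0 1 zero_le_one) a
    rw [rankSum_eq_dropCol hp hu _ (fun _ => True) (fun _ => Iff.rfl)]
    simp only [ih, colLen_dropCol, zero_add]
    rw [sum_ofReal_mul_ofReal hp hu hup _ _ (by positivity), card_eq_colLen_add_card_dropCol mu,
      pow_add, mul_right_comm, h, ← ENNReal.ofReal_mul']
    · congr 1; ring
    · refine mul_nonneg (by positivity) (Finset.sum_nonneg fun b _ => ?_)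
      have := rankWeight_nonneg hp hu hup (mu.colLen 1) b
      have := (shiftedPoch_pos hp hp (a - b)).le
      positivity

/-! ### Moments -/

/-- The factor `(1/p)_d / (1/p)_{d-a}` if `a ≤ d`, and `0` otherwise. -/
def rankFactor (p : ℝ) (d : ℕ∞) (a : ℕ) : ℝ :=
  if (a : ℕ∞) ≤ d then poch p (1 / p) d / poch p (1 / p) (d - a) else 0

theorem rankFactor_nonneg {p : ℝ} (hp : 1 < p) (d : ℕ∞) (a : ℕ) : 0 ≤ rankFactor p d a := by
  rw [rankFactor]
  split_ifs
  · exact div_nonneg (poch_pos hp hp _).le (poch_pos hp hp _).le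
  · exact le_rfl

theorem rankFactor_natCast (p : ℝ) (n a : ℕ) : rankFactor p n a =
    if a ≤ n then shiftedPoch p 1 n / shiftedPoch p 1 (n - a) else 0 := by
  rw [rankFactor]
  simp only [Nat.cast_le, ← ENat.natCast_sub, poch_div_natCast]

theorem rankFactor_top {p : ℝ} (hp : 1 < p) (a : ℕ) : rankFactor p ⊤ a = 1 := by
  rw [rankFactor, if_pos le_top, ENat.top_sub_natCast, div_self (poch_pos hp hp _).ne']

theorem hasSum_rankFactor_natCast {p u : ℝ} (hp : 1 < p) (hu : 0 < u) (hup : u < p) (n s : ℕ) :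
    HasSum (fun a => rankFactor p n a * rankWeight p u s a)
      (rankFactor p n s / shiftedPoch p u n) := by
  have h : rankFactor p n s / shiftedPoch p u n =
      ∑ a ∈ Finset.range (n + 1), rankFactor p n a * rankWeight p u s a := by
    have h1 : ∀ a ∈ Finset.range (n + 1), rankFactor p n a * rankWeight p u s a =
        shiftedPoch p 1 n * (rankWeight p u s a / shiftedPoch p 1 (n - a)) := fun a ha => by
      rw [rankFactor_natCast, if_pos (Nat.lt_succ_iff.mp (Finset.mem_range.mp ha))]
      ring
    rw [Finset.sum_congr rfl h1, ← Finset.mul_sum, sum_rankWeight hp hu hup, rankFactor_natCast]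
    split_ifs
    · rw [mul_one_div, div_div]
    · simp
  rw [h]
  refine hasSum_sum_of_ne_finset_zero fun a ha => ?_
  rw [rankFactor_natCast, if_neg (by simpa using ha), zero_mul]

/-- Dividing each term by a factor `(1/p)_{n-a} ≤ 1` only increases it and makes the partial sum
computable by `sum_rankWeight`. -/
theorem summable_rankWeight {p u : ℝ} (hp : 1 < p) (hu : 0 < u) (hup : u < p) (s : ℕ) :
    Summable (rankWeight p u s) := by
  have hw := rankWeight_nonneg hp hu hup s
  have h1 := poch_pos hp hp ⊤
  have h2 := poch_pos hp hup ⊤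
  refine summable_of_sum_range_le (c := 1 / (poch p (1 / p) ⊤ * poch p (u / p) ⊤)) hw fun n => ?_
  calc ∑ a ∈ Finset.range n, rankWeight p u s a
      ≤ ∑ a ∈ Finset.range (n + 1), rankWeight p u s a :=
        Finset.sum_le_sum_of_subset_of_nonneg (Finset.range_mono n.le_succ) fun a _ _ => hw a
    _ ≤ ∑ a ∈ Finset.range (n + 1), rankWeight p u s a / shiftedPoch p 1 (n - a) := by
        refine Finset.sum_le_sum fun a _ => le_div_self (hw a) (shiftedPoch_pos hp hp _) ?_
        simpa using shiftedPoch_antitone hp zero_le_one hp (Nat.zero_le (n - a))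
    _ ≤ _ := by
        rw [sum_rankWeight hp hu hup]
        split_ifs
        · exact one_div_le_one_div_of_le (mul_pos h1 h2)
            (mul_le_mul (poch_top_le hp zero_le_one hp _) (poch_top_le hp hu.le hup _) h2.le
              (shiftedPoch_pos hp hp _).le)
        · positivity

theorem tendsto_rankFactor {p : ℝ} (hp : 1 < p) (a : ℕ) :
    Tendsto (fun n : ℕ => rankFactor p n a) atTop (𝓝 1) := by
  have h0 := (poch_pos hp hp ⊤).ne'
  have h1 := tendsto_shiftedPoch hp 1
  have h2 := h1.div (h1.comp (tendsto_sub_atTop_nat a)) h0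
  rw [div_self h0] at h2
  refine h2.congr' ?_
  filter_upwards [eventually_ge_atTop a] with n hn
  rw [rankFactor_natCast, if_pos hn]
  rfl

theorem rankFactor_natCast_le_one {p : ℝ} (hp : 1 < p) (n a : ℕ) : rankFactor p n a ≤ 1 := by
  rw [rankFactor_natCast]
  split_ifs
  · rw [div_le_one (shiftedPoch_pos hp hp _)]
    exact shiftedPoch_antitone hp zero_le_one hp (Nat.sub_le n a)
  · exact zero_le_one

/-- The case `d = ∞` is the limit of finite `d`: the rank factors are at most `1` and tend to `1`,
so `rankWeight` dominates. -/
theorem hasSum_rankFactor {p u : ℝ} (hp : 1 < p) (hu : 0 < u) (hup : u < p) (d : ℕ∞) (s : ℕ) :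
    HasSum (fun a => rankFactor p d a * rankWeight p u s a)
      (rankFactor p d s / poch p (u / p) d) := by
  induction d with
  | coe n => rw [poch_div_natCast]; exact hasSum_rankFactor_natCast hp hu hup n s
  | top =>
    have hsum := summable_rankWeight hp hu hup s
    have hw := rankWeight_nonneg hp hu hup s
    simp only [rankFactor_top hp, one_mul]
    have h1 : Tendsto (fun n : ℕ => ∑' a, rankFactor p n a * rankWeight p u s a) atTop
        (𝓝 (∑' a, rankWeight p u s a)) := by
      refine tendsto_tsum_of_dominated_convergence hsum (fun a => ?_)
        (Eventually.of_forall fun n a => ?_)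
      · simpa using (tendsto_rankFactor hp a).mul_const (rankWeight p u s a)
      · rw [Real.norm_of_nonneg (mul_nonneg (rankFactor_nonneg hp _ _) (hw a))]
        exact mul_le_of_le_one_left (hw a) (rankFactor_natCast_le_one hp n a)
    have h2 : Tendsto (fun n : ℕ => ∑' a, rankFactor p n a * rankWeight p u s a) atTop
        (𝓝 (1 / poch p (u / p) ⊤)) := by
      simp only [fun n => (hasSum_rankFactor_natCast hp hu hup n s).tsum_eq]
      exact (tendsto_rankFactor hp s).div (tendsto_shiftedPoch hp u) (poch_pos hp hup ⊤).ne'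
    rw [← tendsto_nhds_unique h1 h2]
    exact hsum.hasSum

theorem hasSum_of_tsum_ofReal {α : Type*} {f : α → ℝ} (hf : ∀ i, 0 ≤ f i) {x : ℝ} (hx : 0 ≤ x)
    (h : ∑' i, ENNReal.ofReal (f i) = ENNReal.ofReal x) : HasSum f x := by
  have h1 := ENNReal.hasSum_toReal (f := fun i => ENNReal.ofReal (f i))
    (by rw [h]; exact ENNReal.ofReal_ne_top)
  simp only [ENNReal.toReal_ofReal (hf _)] at h1
  have h2 : ∑' i, f i = x := by
    rw [← ENNReal.toReal_ofReal hx, ← h, ENNReal.tsum_toReal_eq fun _ => ENNReal.ofReal_ne_top]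
    simp only [ENNReal.toReal_ofReal (hf _)]
  rwa [h2] at h1

theorem hasSum_rankFactor_mul_surWeight {p u : ℝ} (hp : 1 < p) (hu : 0 < u) (hup : u < p)
    (d : ℕ∞) (mu : YoungDiagram) :
    HasSum (fun lam => rankFactor p d (lam.colLen 0) * surWeight p u lam mu)
      (u ^ mu.card * rankFactor p d (mu.colLen 0) / poch p (u / p) d) := by
  have hD := rankFactor_nonneg hp d
  have hw := rankWeight_nonneg hp hu hup (mu.colLen 0)
  have hR := poch_pos hp hup d
  refine hasSum_of_tsum_ofReal (fun lam => mul_nonneg (hD _) (surWeight_nonneg hp hu _ _))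
    (div_nonneg (mul_nonneg (by positivity) (hD _)) hR.le) ?_
  rw [tsum_eq_tsum_colLen]
  have h : ∀ a, ∑' lam : {lam : YoungDiagram // lam.colLen 0 = a},
      ENNReal.ofReal (rankFactor p d (lam.1.colLen 0) * surWeight p u lam mu) =
      ENNReal.ofReal (u ^ mu.card * (rankFactor p d a * rankWeight p u (mu.colLen 0) a)) := by
    intro a
    rw [mul_left_comm, ENNReal.ofReal_mul (hD a), ← rankSum_eq hp hu hup, rankSum,
      ← ENNReal.tsum_mul_left]
    refine tsum_congr fun lam => ?_
    rw [if_pos trivial, lam.2, ENNReal.ofReal_mul (hD a)]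
  simp only [h]
  have hs := (hasSum_rankFactor hp hu hup d (mu.colLen 0)).mul_left (u ^ mu.card)
  rw [← ENNReal.ofReal_tsum_of_nonneg _ hs.summable, hs.tsum_eq, mul_div_assoc]
  exact fun a => mul_nonneg (by positivity) (mul_nonneg (hD a) (hw a))

/-! ### Counting injective homomorphisms -/

/-- The number of injective homomorphisms. -/
def injCount (A B : Type*) [AddCommGroup A] [AddCommGroup B] : ℕ :=
  Nat.card {f : A →+ B // Function.Injective f}

/-- The number of elements killed by `n`. -/
def torsionCount (n : ℕ) (B : Type*) [AddCommGroup B] : ℕ := Nat.card {b : B // n • b = 0}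

theorem injCount_congr {A A' : Type*} (B : Type*) [AddCommGroup A] [AddCommGroup A']
    [AddCommGroup B] (e : A ≃+ A') : injCount A B = injCount A' B := by
  refine Nat.card_congr
    { toFun := fun f => ⟨f.1.comp e.symm.toAddMonoidHom, f.2.comp e.symm.injective⟩
      invFun := fun f => ⟨f.1.comp e.toAddMonoidHom, f.2.comp e.injective⟩
      left_inv := fun f => Subtype.ext (AddMonoidHom.ext fun x => by simp)
      right_inv := fun f => Subtype.ext (AddMonoidHom.ext fun x => by simp) }

/-- The homomorphism `A × ZMod n → B` given by a homomorphism on `A` and the image of `1`. -/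
def prodZModLift {A B : Type*} [AddCommGroup A] [AddCommGroup B] {n : ℕ} (f : A →+ B) (g : B)
    (hg : n • g = 0) : A × ZMod n →+ B :=
  f.coprod (ZMod.lift n ⟨zmultiplesHom B g, by simpa using hg⟩)

theorem prodZModLift_apply {A B : Type*} [AddCommGroup A] [AddCommGroup B] {n : ℕ} (f : A →+ B)
    (g : B) (hg : n • g = 0) (a : A) (z : ℤ) :
    prodZModLift f g hg (a, (z : ZMod n)) = f a + z • g := by
  simp [prodZModLift]

theorem injective_prodZModLift_iff {A B : Type*} [AddCommGroup A] [AddCommGroup B] {q m : ℕ}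
    [Fact q.Prime] (f : A →+ B) (g : B) (hg : q ^ (m + 1) • g = 0) :
    Function.Injective (prodZModLift f g hg) ↔
      Function.Injective f ∧ q ^ m • g ∉ f.range := by
  constructor
  · intro h
    constructor
    · intro a b hab
      have : prodZModLift f g hg (a, ((0 : ℤ) : ZMod _)) =
          prodZModLift f g hg (b, ((0 : ℤ) : ZMod _)) := by
        rw [prodZModLift_apply, prodZModLift_apply, hab]
      exact congrArg Prod.fst (h this)
    · rintro ⟨a, ha⟩
      have : prodZModLift f g hg (a, ((0 : ℤ) : ZMod _)) =
          prodZModLift f g hg (0, (((q ^ m : ℕ) : ℤ) : ZMod _)) := by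
        rw [prodZModLift_apply, prodZModLift_apply, ha, natCast_zsmul]
        simp
      have h2 := congrArg Prod.snd (h this)
      simp only [Int.cast_zero, Int.cast_natCast] at h2
      rw [eq_comm, ZMod.natCast_eq_zero_iff] at h2
      have := Nat.le_of_dvd (pow_pos (Fact.out : q.Prime).pos m) h2
      exact absurd this
        (not_le.mpr (Nat.pow_lt_pow_right (Fact.out : q.Prime).one_lt m.lt_succ_self))
  · rintro ⟨hf, hgr⟩
    rw [injective_iff_map_eq_zero]
    rintro ⟨a, z⟩ h
    obtain ⟨z, rfl⟩ := ZMod.intCast_surjective z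
    rw [prodZModLift_apply] at h
    -- A relation `f a + z • g = 0` kills `z • g` modulo the range, so exact order `q ^ (m + 1)`
    -- there forces `z = 0` in `ZMod (q ^ (m + 1))`.
    have ho : addOrderOf (QuotientAddGroup.mk' f.range g) = q ^ (m + 1) := by
      refine addOrderOf_eq_prime_pow ?_ ?_
      · rw [← map_nsmul]
        exact fun h0 => hgr ((QuotientAddGroup.eq_zero_iff _).mp h0)
      · rw [← map_nsmul, hg, map_zero]
    have hz : z • QuotientAddGroup.mk' f.range g = 0 := by
      rw [← map_zsmul]
      refine (QuotientAddGroup.eq_zero_iff _).mpr ⟨-a, ?_⟩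
      rw [map_neg]
      exact neg_eq_of_add_eq_zero_right h
    have hd := addOrderOf_dvd_iff_zsmul_eq_zero.mpr hz
    rw [ho] at hd
    have hzg : z • g = 0 := by
      obtain ⟨w, rfl⟩ := hd
      rw [mul_comm, mul_zsmul, natCast_zsmul, hg, zsmul_zero]
    rw [hzg, add_zero] at h
    rw [(injective_iff_map_eq_zero f).mp hf a h, (ZMod.intCast_zmod_eq_zero_iff_dvd z _).mpr hd]
    rfl

/-- An injective homomorphism from `A × ZMod (q ^ (m + 1))` is an injective homomorphism `f` from
`A` together with an element of exact order `q ^ (m + 1)` modulo the range of `f`. -/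
def injProdZModEquiv (A B : Type*) [AddCommGroup A] [AddCommGroup B] (q m : ℕ) [Fact q.Prime] :
    {f : A × ZMod (q ^ (m + 1)) →+ B // Function.Injective f} ≃
      Σ f : {f : A →+ B // Function.Injective f},
        {g : B // q ^ (m + 1) • g = 0 ∧ q ^ m • g ∉ f.1.range} :=
  have key : ∀ f : A × ZMod (q ^ (m + 1)) →+ B, ∃ h : q ^ (m + 1) • f (0, 1) = 0,
      prodZModLift (f.comp (AddMonoidHom.inl _ _)) (f (0, 1)) h = f := by
    intro f
    have h : q ^ (m + 1) • f (0, 1) = 0 := by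
      rw [← map_nsmul, Prod.smul_mk, nsmul_one, ZMod.natCast_self, smul_zero]
      exact map_zero f
    refine ⟨h, AddMonoidHom.ext ?_⟩
    rintro ⟨a, z⟩
    obtain ⟨z, rfl⟩ := ZMod.intCast_surjective z
    rw [prodZModLift_apply, ← map_zsmul, AddMonoidHom.comp_apply, ← map_add]
    simp
  { toFun := fun f =>
      have h := (key f.1).choose_spec.symm ▸ f.2
      have h2 := (injective_prodZModLift_iff _ _ _).mp h
      ⟨⟨f.1.comp (AddMonoidHom.inl _ _), h2.1⟩, ⟨f.1 (0, 1), (key f.1).choose, h2.2⟩⟩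
    invFun := fun x => ⟨prodZModLift x.1.1 x.2.1 x.2.2.1,
      (injective_prodZModLift_iff _ _ _).mpr ⟨x.1.2, x.2.2.2⟩⟩
    left_inv := fun f => Subtype.ext (key f.1).choose_spec
    right_inv := by
      rintro ⟨⟨f, hf⟩, ⟨g, hg, hgr⟩⟩
      have h1 : (prodZModLift f g hg).comp (AddMonoidHom.inl _ _) = f := by
        refine AddMonoidHom.ext fun a => ?_
        have := prodZModLift_apply f g hg a 0
        simpa using this
      have h2 : prodZModLift f g hg (0, 1) = g := by
        have := prodZModLift_apply f g hg 0 1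
        simpa using this
      exact Sigma.subtype_ext (Subtype.ext h1) h2 }

/-- If `q ^ m • g = f a`, injectivity gives `q • a = 0`. Conversely each such `a` is `q ^ m • s a`,
so the solutions `g` over it form the coset of `f (s a)` under the `q ^ m`-torsion of `B`. -/
theorem card_nsmul_mem_range {A B : Type*} [AddCommGroup A] [AddCommGroup B] [Finite A] [Finite B]
    {q m : ℕ} (hA : ∀ a : A, q • a = 0 → ∃ a', q ^ m • a' = a) {f : A →+ B}
    (hf : Function.Injective f) :
    Nat.card {g : B // q ^ (m + 1) • g = 0 ∧ q ^ m • g ∈ f.range} =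
      torsionCount q A * torsionCount (q ^ m) B := by
  choose s hs using hA
  rw [torsionCount, torsionCount, ← Nat.card_prod]
  symm
  refine Nat.card_congr (Equiv.ofBijective (fun x => ⟨f (s x.1.1 x.1.2) + x.2.1, ?_, ?_⟩) ⟨?_, ?_⟩)
  · rw [pow_succ', mul_smul, smul_add, ← map_nsmul, hs, x.2.2, add_zero, ← map_nsmul, x.1.2,
      map_zero]
  · rw [smul_add, ← map_nsmul, hs, x.2.2, add_zero]
    exact ⟨_, rfl⟩
  · rintro ⟨⟨a, ha⟩, ⟨b, hb⟩⟩ ⟨⟨a', ha'⟩, ⟨b', hb'⟩⟩ h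
    have h0 : f (s a ha) + b = f (s a' ha') + b' := congrArg Subtype.val h
    have h1 := congrArg (q ^ m • ·) h0
    simp only [smul_add, ← map_nsmul, hs, hb, hb', add_zero] at h1
    obtain rfl := hf h1
    obtain rfl := add_left_cancel h0
    rfl
  · rintro ⟨g, hg, ⟨a, ha⟩⟩
    have h1 : q • a = 0 := by
      refine hf ?_
      rw [map_nsmul, ha, ← mul_smul, ← pow_succ', hg, map_zero]
    refine ⟨⟨⟨a, h1⟩, ⟨g - f (s a h1), ?_⟩⟩, Subtype.ext (by simp)⟩
    rw [smul_sub, ← map_nsmul, hs, ha, sub_self]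

theorem injCount_prod_zmod (A B : Type*) [AddCommGroup A] [AddCommGroup B] [Finite A] [Finite B]
    {q m : ℕ} [Fact q.Prime] (hA : ∀ a : A, q • a = 0 → ∃ a', q ^ m • a' = a) :
    (injCount (A × ZMod (q ^ (m + 1))) B : ℤ) = injCount A B *
      (torsionCount (q ^ (m + 1)) B - torsionCount q A * torsionCount (q ^ m) B) := by
  have : Finite (A →+ B) := DFunLike.finite _
  have := Fintype.ofFinite {f : A →+ B // Function.Injective f}
  rw [injCount, Nat.card_congr (injProdZModEquiv A B q m), Nat.card_sigma, Nat.cast_sum]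
  have h : ∀ f : {f : A →+ B // Function.Injective f},
      (Nat.card {g : B // q ^ (m + 1) • g = 0 ∧ q ^ m • g ∉ f.1.range} : ℤ) =
        torsionCount (q ^ (m + 1)) B - torsionCount q A * torsionCount (q ^ m) B := by
    intro f
    have h1 := card_nsmul_mem_range (B := B) hA f.2
    have h2 := Set.ncard_inter_add_ncard_sdiff_eq_ncard {g : B | q ^ (m + 1) • g = 0}
      {g : B | q ^ m • g ∈ f.1.range} (Set.toFinite _)
    have h3 : Nat.card {g : B // q ^ (m + 1) • g = 0 ∧ q ^ m • g ∈ f.1.range} +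
        Nat.card {g : B // q ^ (m + 1) • g = 0 ∧ q ^ m • g ∉ f.1.range} =
        torsionCount (q ^ (m + 1)) B := h2
    rw [← h3, h1]
    push_cast
    ring
  simp only [h, Finset.sum_const, Finset.card_univ, nsmul_eq_mul]
  rw [injCount, Nat.card_eq_fintype_card]

theorem torsionCount_zmod (q e m : ℕ) [Fact q.Prime] :
    torsionCount (q ^ m) (ZMod (q ^ e)) = q ^ min e m := by
  have h := IsAddCyclic.card_nsmulAddMonoidHom_ker (ZMod (q ^ e)) (q ^ m)
  refine h.trans ?_
  rw [Nat.card_zmod]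
  rcases le_total e m with hem | hem
  · rw [min_eq_left hem, Nat.gcd_eq_left (pow_dvd_pow q hem)]
  · rw [min_eq_right hem, Nat.gcd_eq_right (pow_dvd_pow q hem)]

theorem torsionCount_pi {ι : Type*} [Fintype ι] (G : ι → Type*) [∀ i, AddCommGroup (G i)] (n : ℕ) :
    torsionCount n (∀ i, G i) = ∏ i, torsionCount n (G i) := by
  simp only [torsionCount]
  rw [← Nat.card_pi]
  refine Nat.card_congr ((Equiv.subtypeEquivRight fun f => ?_).trans
    (Equiv.subtypePiEquivPi (p := fun i (b : G i) => n • b = 0)))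
  exact funext_iff

theorem exists_pow_nsmul_eq {q e m : ℕ} [Fact q.Prime] (hme : m + 1 ≤ e) (x : ZMod (q ^ e))
    (hx : q • x = 0) : ∃ y, q ^ m • y = x := by
  obtain ⟨v, rfl⟩ := ZMod.natCast_zmod_surjective x
  obtain ⟨k, rfl⟩ := Nat.exists_eq_add_of_le hme
  rw [nsmul_eq_mul, ← Nat.cast_mul, ZMod.natCast_eq_zero_iff] at hx
  have h1 : q ^ m * q ^ k ∣ v := by
    rw [← pow_add]
    refine Nat.dvd_of_mul_dvd_mul_left (Fact.out : q.Prime).pos ?_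
    rwa [← pow_succ', add_right_comm]
  obtain ⟨w, rfl⟩ := h1
  exact ⟨((q ^ k * w : ℕ) : ZMod _), by rw [nsmul_eq_mul, ← Nat.cast_mul, mul_assoc]⟩

/-- Splitting off the last cyclic factor. -/
def piZModSuccEquiv (q : ℕ) (e : ℕ → ℕ) (k : ℕ) :
    (∀ i : Fin (k + 1), ZMod (q ^ e i)) ≃+ (∀ i : Fin k, ZMod (q ^ e i)) × ZMod (q ^ e k) :=
  { ((Fin.snocEquiv fun i : Fin (k + 1) => ZMod (q ^ e i)).symm.trans (Equiv.prodComm _ _)) with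
    map_add' := fun _ _ => rfl }

theorem injCount_piZMod (B : Type*) [AddCommGroup B] [Finite B] {q : ℕ} [Fact q.Prime] {e : ℕ → ℕ}
    (he : Antitone e) (k : ℕ) (hk : ∀ i < k, 0 < e i) :
    (injCount (∀ i : Fin k, ZMod (q ^ e i)) B : ℤ) = ∏ i ∈ Finset.range k,
      ((torsionCount (q ^ e i) B : ℤ) - q ^ i * torsionCount (q ^ (e i - 1)) B) := by
  induction k with
  | zero =>
    have : Unique {f : (∀ i : Fin 0, ZMod (q ^ e i)) →+ B // Function.Injective f} :=
      { default := ⟨0, Function.injective_of_subsingleton _⟩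
        uniq := fun f => Subtype.ext (AddMonoidHom.ext fun x => by
          rw [Subsingleton.elim x 0, map_zero, map_zero]) }
    rw [injCount, Nat.card_unique]
    simp
  | succ k ih =>
    have hek : 0 < e k := hk k k.lt_succ_self
    obtain ⟨m, hm⟩ := Nat.exists_eq_add_of_lt hek
    rw [zero_add] at hm
    have htors : torsionCount q (∀ i : Fin k, ZMod (q ^ e i)) = q ^ k := by
      rw [torsionCount_pi, Finset.prod_congr rfl fun i _ => ?_, Finset.prod_const,
        Finset.card_univ, Fintype.card_fin]
      have := torsionCount_zmod q (e i) 1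
      rwa [pow_one, min_eq_right (hk i (i.2.trans k.lt_succ_self)), pow_one] at this
    -- Generators are added in order of decreasing exponent, so every earlier exponent is at least
    -- `m + 1`.
    have hdiv : ∀ a : ∀ i : Fin k, ZMod (q ^ e i), q • a = 0 → ∃ a', q ^ m • a' = a := by
      intro a ha
      have h1 : ∀ i : Fin k, ∃ y, q ^ m • y = a i := fun i =>
        exists_pow_nsmul_eq (by rw [← hm]; exact he i.2.le) (a i) (congrFun ha i)
      choose y hy using h1
      exact ⟨y, funext hy⟩
    rw [Finset.prod_range_succ, ← ih fun i hi => hk i (hi.trans k.lt_succ_self),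
      injCount_congr B (piZModSuccEquiv q e k), hm, injCount_prod_zmod _ B hdiv, htors,
      Nat.add_sub_cancel]
    push_cast
    ring

/-- Both sides count the cells in the first `m` columns. -/
theorem sum_min_rowLen (lam : YoungDiagram) (m : ℕ) :
    ∑ i ∈ Finset.range (lam.colLen 0), min (lam.rowLen i) m =
      ∑ j ∈ Finset.range m, lam.colLen j := by
  induction m with
  | zero => simp
  | succ m ih =>
    rw [Finset.sum_range_succ, ← ih]
    have h1 : ∀ i, min (lam.rowLen i) (m + 1) =
        min (lam.rowLen i) m + if i < lam.colLen m then 1 else 0 := by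
      intro i
      simp only [lt_colLen_iff_lt_rowLen]
      split_ifs <;> omega
    have h2 : (Finset.range (lam.colLen 0)).filter (fun i => i < lam.colLen m) =
        Finset.range (lam.colLen m) := by
      have := lam.colLen_anti 0 m (Nat.zero_le m)
      ext i
      simp only [Finset.mem_filter, Finset.mem_range]
      omega
    rw [Finset.sum_congr rfl fun i _ => h1 i, Finset.sum_add_distrib, Finset.sum_boole, h2]
    simp

theorem torsionCount_groupOfType (q m : ℕ) [Fact q.Prime] (lam : YoungDiagram) :
    torsionCount (q ^ m) (GroupOfType q lam) = q ^ ∑ j ∈ Finset.range m, lam.colLen j := by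
  rw [torsionCount_pi, ← sum_min_rowLen, ← Finset.prod_pow_eq_pow_sum, Finset.prod_range]
  exact Finset.prod_congr rfl fun i _ => torsionCount_zmod q _ m

theorem injCount_groupOfType (q : ℕ) [Fact q.Prime] (lam mu : YoungDiagram) :
    (injCount (GroupOfType q mu) (GroupOfType q lam) : ℤ) = (injPoly lam mu).eval (q : ℤ) := by
  have he : Antitone mu.rowLen := fun i j => mu.rowLen_anti i j
  have hk : ∀ i < mu.colLen 0, 0 < mu.rowLen i := fun i => lt_colLen_iff_lt_rowLen.mp
  rw [injCount_piZMod _ he _ hk, injPoly, eval_prod]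
  refine Finset.prod_congr rfl fun i hi => ?_
  obtain ⟨m, hm⟩ := Nat.exists_eq_add_of_lt (hk i (Finset.mem_range.mp hi))
  rw [zero_add] at hm
  rw [hm, Nat.add_sub_cancel, torsionCount_groupOfType, torsionCount_groupOfType,
    Finset.sum_range_succ, pow_add]
  simp
  ring

theorem card_injective_range_eq {A B : Type*} [AddCommGroup A] [AddCommGroup B] [Finite A]
    (H : AddSubgroup B) (e : H ≃+ A) :
    Nat.card {f : {f : A →+ B // Function.Injective f} // f.1.range = H} = injCount A A := by
  refine Nat.card_congr
    { toFun := fun f => ⟨e.toAddMonoidHom.comp (f.1.1.codRestrict H fun x => ?_), ?_⟩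
      invFun := fun f => ⟨⟨H.subtype.comp (e.symm.toAddMonoidHom.comp f.1), ?_⟩, ?_⟩
      left_inv := fun f => ?_
      right_inv := fun f => ?_ }
  · exact (SetLike.ext_iff.mp f.2 _).mp ⟨x, rfl⟩
  · refine e.injective.comp fun x y hxy => f.1.2 (congrArg Subtype.val hxy)
  · exact H.subtype_injective.comp (e.symm.injective.comp f.2)
  · have hs : Function.Surjective f.1 := Finite.surjective_of_injective f.2
    ext b
    constructor
    · rintro ⟨x, rfl⟩
      exact (e.symm (f.1 x)).2
    · intro hb
      obtain ⟨x, hx⟩ := hs (e ⟨b, hb⟩)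
      exact ⟨x, by simp [hx]⟩
  · refine Subtype.ext (Subtype.ext (AddMonoidHom.ext fun x => ?_))
    simp
  · refine Subtype.ext (AddMonoidHom.ext fun x => ?_)
    simp [AddMonoidHom.codRestrict]

/-- Injections are grouped by range; those with a given range `H ≃+ A` correspond to injective
endomorphisms of `A`. -/
theorem injCount_eq_mul (A B : Type*) [AddCommGroup A] [AddCommGroup B] [Finite A] [Finite B] :
    injCount A B =
      Nat.card {H : AddSubgroup B // Nonempty (H ≃+ A)} * injCount A A := by
  have : Finite (A →+ B) := DFunLike.finite _
  have := Fintype.ofFinite {H : AddSubgroup B // Nonempty (H ≃+ A)}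
  let r : {f : A →+ B // Function.Injective f} → {H : AddSubgroup B // Nonempty (H ≃+ A)} :=
    fun f => ⟨f.1.range, ⟨(AddMonoidHom.ofInjective f.2).symm⟩⟩
  rw [injCount, ← Nat.card_congr (Equiv.sigmaFiberEquiv r), Nat.card_sigma,
    Finset.sum_congr rfl fun H _ => ?_, Finset.sum_const, Finset.card_univ, smul_eq_mul,
    Nat.card_eq_fintype_card]
  rw [← card_injective_range_eq H.1 H.2.some]
  exact Nat.card_congr (Equiv.subtypeEquivRight fun f => Subtype.ext_iff)

theorem subgroupCount_mul_injPoly_eval (q : ℕ) [Fact q.Prime] (lam mu : YoungDiagram) :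
    (subgroupCount q lam mu : ℤ) * (injPoly mu mu).eval (q : ℤ) =
      (injPoly lam mu).eval (q : ℤ) := by
  rw [← injCount_groupOfType, ← injCount_groupOfType,
    injCount_eq_mul (GroupOfType q mu) (GroupOfType q lam), Nat.cast_mul]
  rfl

/-! ### Polynomiality -/

theorem injPoly_monic (mu : YoungDiagram) : (injPoly mu mu).Monic := by
  refine monic_prod_of_monic _ _ fun i hi => (monic_X_pow _).mul ?_
  have h : i < mu.colLen (mu.rowLen i - 1) := by
    have := lt_colLen_iff_lt_rowLen.mp (Finset.mem_range.mp hi)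
    rw [lt_colLen_iff_lt_rowLen]
    omega
  obtain ⟨n, hn⟩ := Nat.exists_eq_add_of_lt h
  rw [hn]
  refine monic_X_pow_sub ?_
  rw [degree_X_pow]
  exact_mod_cast Nat.lt_succ_of_le (Nat.le_add_right i n)

theorem eval_map_natCast (f : ℤ[X]) (n : ℕ) :
    (f.map (Int.castRingHom ℝ)).eval (n : ℝ) = ((f.eval (n : ℤ) : ℤ) : ℝ) := by
  rw [eval_map, ← Int.cast_natCast n, ← eq_intCast (Int.castRingHom ℝ) (n : ℤ), eval₂_hom]
  rfl

/-- An integral polynomial divisible by a monic one at all primes is divisible by it. -/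
theorem dvd_of_forall_prime_eval_dvd {f g : ℤ[X]} (hg : g.Monic)
    (h : ∀ q : ℕ, q.Prime → g.eval (q : ℤ) ∣ f.eval (q : ℤ)) : g ∣ f := by
  rw [← modByMonic_eq_zero_iff_dvd hg]
  set r := f %ₘ g with hr
  have hdeg : (r.map (Int.castRingHom ℝ)).degree < (g.map (Int.castRingHom ℝ)).degree := by
    rw [degree_map_eq_of_injective Int.cast_injective, degree_map_eq_of_injective Int.cast_injective]
    exact degree_modByMonic_lt f hg
  -- At primes `r/g` is an integer wherever `g ≠ 0`, and it tends to zero. Thus `r` vanishes at all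
  -- large primes.
  have hlim := (div_tendsto_atTop_zero_of_degree_lt _ _ hdeg).comp
    (tendsto_natCast_atTop_atTop (R := ℝ))
  have hev := hlim.eventually (Metric.ball_mem_nhds (0 : ℝ) one_pos)
  obtain ⟨N, hN⟩ := Filter.eventually_atTop.mp hev
  have hroot : ∀ q : ℕ, q.Prime → N ≤ q → r.eval (q : ℤ) = 0 := by
    intro q hq hNq
    have h1 : g.eval (q : ℤ) ∣ r.eval (q : ℤ) := by
      rw [hr, modByMonic_eq_sub_mul_div, eval_sub, eval_mul]
      exact dvd_sub (h q hq) (dvd_mul_right _ _)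
    obtain ⟨c, hc⟩ := h1
    have h2 := hN q hNq
    simp only [Function.comp_apply, eval_map_natCast, hc] at h2
    rcases eq_or_ne (g.eval (q : ℤ)) 0 with h0 | h0
    · rw [hc, h0, zero_mul]
    · have h0' : ((g.eval (q : ℤ) : ℤ) : ℝ) ≠ 0 := Int.cast_ne_zero.mpr h0
      rw [Int.cast_mul, mul_div_cancel_left₀ _ h0', dist_zero_right, Real.norm_eq_abs] at h2
      have hc0 : c = 0 := by
        rw [← Int.abs_lt_one_iff]
        exact_mod_cast h2
      rw [hc, hc0, mul_zero]
  refine eq_zero_of_infinite_isRoot _ ?_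
  have hinf := (Nat.infinite_setOfPred_prime.sdiff (Set.finite_lt_nat N)).image
    (f := fun n : ℕ => (n : ℤ)) Nat.cast_injective.injOn
  refine hinf.mono ?_
  rintro _ ⟨q, ⟨hq, hNq⟩, rfl⟩
  exact hroot q hq (not_lt.mp hNq)

theorem eval_map_injPoly (p : ℝ) (lam mu : YoungDiagram) :
    ((injPoly lam mu).map (Int.castRingHom ℝ)).eval p = injCard p lam mu := by
  rw [injPoly, Polynomial.map_prod, eval_prod, injCard]
  simp

/-- Divisibility at primes makes the quotient of `injPoly lam mu` by `injPoly mu mu` a polynomial,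
which must be `subgroupPoly`. At real `p` the denominator is `|Aut(mu)|`. -/
theorem surCard_eq_injCard {p : ℝ} (hp : 1 < p) (lam mu : YoungDiagram) :
    surCard p lam mu = injCard p lam mu := by
  obtain ⟨f, hf⟩ := dvd_of_forall_prime_eval_dvd (f := injPoly lam mu) (injPoly_monic mu)
    fun q hq => by
      have := Fact.mk hq
      exact ⟨_, by rw [← subgroupCount_mul_injPoly_eval, mul_comm]⟩
  have hmul : ∀ x : ℝ, injCard x lam mu =
      injCard x mu mu * (f.map (Int.castRingHom ℝ)).eval x := by
    intro x
    rw [← eval_map_injPoly, hf, Polynomial.map_mul, eval_mul, eval_map_injPoly]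
  have hsub : subgroupPoly lam mu = f.map (Int.castRingHom ℝ) := by
    refine subgroupPoly_eq _ _ _ fun q hq => ?_
    have := Fact.mk hq
    have hq1 : (1 : ℝ) < q := by exact_mod_cast hq.one_lt
    have h0 : injCard (q : ℝ) mu mu ≠ 0 := by
      rw [injCard_self hq1]
      exact (autCard_pos hq1 mu).ne'
    refine mul_left_cancel₀ h0 ?_
    rw [← hmul, ← eval_map_injPoly, ← eval_map_injPoly, eval_map_natCast, eval_map_natCast,
      ← subgroupCount_mul_injPoly_eval]
    push_cast
    ring
  rw [surCard, hsub, hmul, injCard_self hp, mul_comm]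

/-! ### Uniqueness -/

theorem momentValue_eq (p u : ℝ) (d : ℕ∞) (mu : YoungDiagram) :
    momentValue p u d mu = u ^ mu.card * rankFactor p d (mu.colLen 0) := by
  rw [momentValue, rankFactor]
  split_ifs
  · rw [mul_div_assoc]
  · rw [mul_zero]

theorem momentValue_nonneg {p u : ℝ} (hp : 1 < p) (hu : 0 < u) (d : ℕ∞) (mu : YoungDiagram) :
    0 ≤ momentValue p u d mu := by
  rw [momentValue_eq]
  exact mul_nonneg (by positivity) (rankFactor_nonneg hp _ _)

theorem cohenLenstraMass_eq (p u : ℝ) (d : ℕ∞) (lam : YoungDiagram) :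
    cohenLenstraMass p u d lam =
      poch p (u / p) d * (momentValue p u d lam / autCard p lam) := by
  rw [cohenLenstraMass, momentValue]
  split_ifs
  · ring
  · simp

theorem hasSum_momentValue_mul_surCard {p u : ℝ} (hp : 1 < p) (hu : 0 < u) (hup : u < p) (d : ℕ∞)
    (mu : YoungDiagram) :
    HasSum (fun lam => momentValue p u d lam / autCard p lam * surCard p lam mu)
      (momentValue p u d mu / poch p (u / p) d) := by
  rw [momentValue_eq]
  convert! hasSum_rankFactor_mul_surWeight hp hu hup d mu using 2 with lam
  rw [momentValue_eq, surCard_eq_injCard hp, surWeight]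
  ring

/-- The distribution `P_{d,u}` has the prescribed moments. -/
theorem hasSum_cohenLenstraMass_mul_surCard {p u : ℝ} (hp : 1 < p) (hu : 0 < u) (hup : u < p)
    (d : ℕ∞) (mu : YoungDiagram) :
    HasSum (fun lam => cohenLenstraMass p u d lam * surCard p lam mu) (momentValue p u d mu) := by
  have h := (hasSum_momentValue_mul_surCard hp hu hup d mu).mul_left (poch p (u / p) d)
  rw [mul_div_cancel₀ _ (poch_pos hp hup d).ne'] at h
  simpa only [cohenLenstraMass_eq, mul_assoc] using h

theorem surCard_nonneg {p : ℝ} (hp : 1 < p) (lam mu : YoungDiagram) : 0 ≤ surCard p lam mu := by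
  rw [surCard_eq_injCard hp]
  exact injCard_nonneg hp lam mu

theorem surCard_self {p : ℝ} (hp : 1 < p) (mu : YoungDiagram) :
    surCard p mu mu = autCard p mu := by
  rw [surCard_eq_injCard hp, injCard_self hp]

/-- A signed mass with vanishing moments which is dominated by a multiple of the reference mass
is dominated by a smaller multiple. -/
theorem abs_le_of_hasSum_zero {p u : ℝ} (hp : 1 < p) (hu : 0 < u) (hup : u < p) {d : ℕ∞}
    {e : YoungDiagram → ℝ} {C : ℝ}
    (he : ∀ mu, HasSum (fun lam => e lam * surCard p lam mu) 0)
    (hC : ∀ lam, |e lam| ≤ C * (momentValue p u d lam / autCard p lam)) (mu : YoungDiagram) :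
    |e mu| ≤ C * (1 / poch p (u / p) d - 1) * (momentValue p u d mu / autCard p mu) := by
  have hA := autCard_pos hp mu
  have hM := (hasSum_momentValue_mul_surCard hp hu hup d mu).mul_left C
  have key : ∀ f : YoungDiagram → ℝ, HasSum (fun lam => f lam * surCard p lam mu) 0 →
      (∀ lam, |f lam| ≤ C * (momentValue p u d lam / autCard p lam)) →
      f mu ≤ C * (1 / poch p (u / p) d - 1) * (momentValue p u d mu / autCard p mu) := by
    intro f hf hfC
    -- The terms `(C w + f) |Sur|` are nonnegative, so the one at `mu` is at most the whole sum, to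
    -- which `f` contributes `0`.
    have h := le_hasSum (hM.add hf) mu fun lam _ => by
      have h1 := mul_le_mul_of_nonneg_right (neg_le_of_abs_le (hfC lam)) (surCard_nonneg hp lam mu)
      linarith
    rw [surCard_self hp, div_mul_cancel₀ _ hA.ne', add_zero] at h
    rw [mul_div_assoc', le_div_iff₀ hA]
    calc f mu * autCard p mu ≤ C * (momentValue p u d mu / poch p (u / p) d) -
          C * momentValue p u d mu := by linarith
      _ = _ := by ring
  refine abs_le'.mpr ⟨key e (he mu) hC, key (fun lam => -e lam) ?_ fun lam => ?_⟩
  · simpa using (he mu).neg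
  · rw [abs_neg]; exact hC lam

theorem eq_zero_of_hasSum_zero {p u : ℝ} (hp : 1 < p) (hu : 0 < u) (hup : u < p) {d : ℕ∞}
    (hprod : 1 / poch p (u / p) d < 2) {e : YoungDiagram → ℝ} {C : ℝ}
    (he : ∀ mu, HasSum (fun lam => e lam * surCard p lam mu) 0)
    (hC : ∀ lam, |e lam| ≤ C * (momentValue p u d lam / autCard p lam)) (mu : YoungDiagram) :
    e mu = 0 := by
  set r := 1 / poch p (u / p) d - 1 with hr
  have hiter : ∀ (n : ℕ) (lam : YoungDiagram),
      |e lam| ≤ C * r ^ n * (momentValue p u d lam / autCard p lam) := by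
    intro n
    induction n with
    | zero => simpa using hC
    | succ n ih =>
      intro lam
      rw [pow_succ, ← mul_assoc]
      exact abs_le_of_hasSum_zero hp hu hup he ih lam
  have hpos : 0 < 1 / poch p (u / p) d := one_div_pos.mpr (poch_pos hp hup d)
  have hlim := ((tendsto_pow_atTop_nhds_zero_of_abs_lt_one
    (abs_lt.mpr ⟨by linarith, by linarith⟩ : |r| < 1)).const_mul C).mul_const
      (momentValue p u d mu / autCard p mu)
  rw [mul_zero, zero_mul] at hlim
  exact abs_nonpos_iff.mp (ge_of_tendsto' hlim fun n => hiter n mu)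

end CohenLenstra

end

theorem mainTheorem2 (p u : ℝ) (d : ℕ∞) (hp : 1 < p) (hu : 0 < u) (hup : u < p)
    (hprod : 1 / CohenLenstra.poch p (u / p) d < 2)
    (ν : PMF YoungDiagram)
    (hmoments : ∀ mu : YoungDiagram,
      HasSum (fun lam : YoungDiagram => (ν lam).toReal * CohenLenstra.surCard p lam mu)
        (CohenLenstra.momentValue p u d mu)) :
    ∀ lam : YoungDiagram, (ν lam).toReal = CohenLenstra.cohenLenstraMass p u d lam := by
  open CohenLenstra in
  have hR := poch_pos hp hup d
  have hν : ∀ lam, (ν lam).toReal ≤ momentValue p u d lam / autCard p lam := by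
    intro lam
    have h := le_hasSum (hmoments lam) lam fun mu _ =>
      mul_nonneg ENNReal.toReal_nonneg (surCard_nonneg hp mu lam)
    rwa [surCard_self hp, ← le_div_iff₀ (autCard_pos hp lam)] at h
  intro lam
  -- The constant adds the bounds `ν ≤ w` and `P_{d,u} = (u/p)_d w`.
  refine sub_eq_zero.mp (eq_zero_of_hasSum_zero hp hu hup hprod (C := 1 + poch p (u / p) d)
    (e := fun lam => (ν lam).toReal - cohenLenstraMass p u d lam) (fun mu => ?_) (fun mu => ?_) lam)
  · simpa only [sub_mul, sub_self] using
      (hmoments mu).sub (hasSum_cohenLenstraMass_mul_surCard hp hu hup d mu)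
  · have h0 : 0 ≤ momentValue p u d mu / autCard p mu :=
      div_nonneg (momentValue_nonneg hp hu d mu) (autCard_pos hp mu).le
    have h1 := hν mu
    have h2 : 0 ≤ (ν mu).toReal := ENNReal.toReal_nonneg
    have h3 := mul_nonneg hR.le h0
    rw [cohenLenstraMass_eq, abs_le]
    constructor <;> linarith
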